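/- Let $d$ be a dimension and $\Theta\subset\mathbb R^d$ a convex bounded set with non-empty interior, $\theta\in\Theta$. Let $X_i=(X_{i1},\dots,X_{im_i})$, $m_i\ge 1$, $i=1,2,\dots$, be independent clusters of $\mathbb R^d$-valued random variables on one probability space, such that all $X_{ij}$ have the same law $P_\theta$, which is absolutely continuous with respect to Lebesgue measure, and such that in each cluster $i$ all pairs $(X_{ij},X_{ij'})$, $j\ne j'$, have the same law. Let $N_n=\sum_{i=1}^n m_i$ and suppose $N_n/n\to\ell\in(0,\infty)$. Let $w_{ij}>0$ be non-random weights and $w_{i\cdot}=\sum_{j=1}^{m_i}w_{ij}$. Let $\rho:\mathbb R^d\to\mathbb R$ be differentiable; let $\psi(x-a)$ denote the gradient of $a\mapsto\rho(x-a)$, suppose that $\psi$ is differentiable, and let $\dot\psi(x-a)=\partial\psi(x-a)/\partial a$ be the $d\times d$ Jacobian matrix with respect to $a$. Assume: * $\rho(X_{11}-a)$ is integrable for every $a\in\Theta$ and $\theta$ minimizes $a\mapsto E\rho(X_{11}-a)$ over $\Theta$; * $\theta$ is the unique zero of $a\mapsto E\psi(X_{11}-a)$ in the closure $\overline\Theta$;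 * $a\mapsto\dot\psi(x-a)$ is Hölder on $\Theta$ uniformly in $x$: there are $k$ and $\lambda\in(0,1]$ with $\|\dot\psi(x-a)-\dot\psi(x-b)\|\le k\|a-b\|^\lambda$ for all $x\in\mathbb R^d$, $a,b\in\Theta$; * the entries of $\dot\psi(X_{11}-\theta)$ are square integrable and $V_\theta=E\dot\psi(X_{11}-\theta)$ is invertible; * $\frac1{N_n}\sum_{i=1}^n\sum_{j=1}^{m_i}w_{ij}\to1$ and $\sum_{i\ge1}w_{i\cdot}^2/i^2<\infty$; * $\frac1{N_n}\sum_{i=1}^n\sum_{j=1}^{m_i}w_{ij}^2\to c_w$ for a finite constant $c_w$; * $\frac1{N_n}\sum_{i=1}^n\sum_{j=1}^{m_i}\sum_{j'\ne j}w_{ij}w_{ij'}C_i\to C_\theta^w$, where $C_i=E\,\psi(X_{ij}-\theta)\psi^{T}(X_{ij'}-\theta)$ for $j\ne j'$; * for some $\eta>0$, $\frac1{N_n}\sum_{i=1}^n w_{i\cdot}^{2+\eta}$ converges to a finite limit and $E\|\psi(X_{11}-\theta)\|^{2+\eta}<\infty$. Let $\widehat\theta_n^w$ be a weighted M-estimator,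 that is, a sequence of random vectors such that almost surely, for all sufficiently large $n$, $\widehat\theta_n^w\in\Theta$ and $$\sum_{i=1}^n\sum_{j=1}^{m_i}w_{ij}\,\psi(X_{ij}-\widehat\theta_n^w)=0.$$ Then 1. $\widehat\theta_n^w\to\theta$ almost surely; 2. $\sqrt{N_n}\,(\widehat\theta_n^w-\theta)$ converges in distribution to $N(0,\Sigma_\theta^w)$, where $\Sigma_\theta^w=V_\theta^{-1}(c_wB_\theta+C_\theta^w)V_\theta^{-1}$ (a positive semidefinite matrix) and $B_\theta=E\,\psi(X_{11}-\theta)\psi^{T}(X_{11}-\theta)$. -/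

import Mathlib

open MeasureTheory ProbabilityTheory Filter Topology

noncomputable section

namespace ClusteredM

/-- `N_n = m_1 + ... + m_n`, the number of observations in the first `n` clusters
(clusters are numbered from `0`). -/
def totalSize (m : ℕ → ℕ) (n : ℕ) : ℕ := ∑ i ∈ Finset.range n, m i

/-- `w_{i.}`, the total weight of cluster `i`. -/
def clusterWeight {m : ℕ → ℕ} (w : (i : ℕ) → Fin (m i) → ℝ) (i : ℕ) : ℝ := ∑ j, w i j

/-- The location score `ψ(x - a)`: the vector of the partial derivatives of `a ↦ ρ (x - a)`,
taken with respect to `a`. -/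
def score {d : ℕ} (ρ : EuclideanSpace ℝ (Fin d) → ℝ) (x a : EuclideanSpace ℝ (Fin d)) :
    EuclideanSpace ℝ (Fin d) :=
  gradient (fun b => ρ (x - b)) a

/-- `ψ̇(x - a)`, the derivative of `a ↦ ψ(x - a)`, as a linear map. -/
def scoreDeriv {d : ℕ} (ρ : EuclideanSpace ℝ (Fin d) → ℝ) (x a : EuclideanSpace ℝ (Fin d)) :
    EuclideanSpace ℝ (Fin d) →L[ℝ] EuclideanSpace ℝ (Fin d) :=
  fderiv ℝ (score ρ x) a

/-- The matrix of `ψ̇(x - a)`: the `(k, l)` entry is `∂ψ_k(x - a)/∂a_l`. -/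
def scoreJacobian {d : ℕ} (ρ : EuclideanSpace ℝ (Fin d) → ℝ) (x a : EuclideanSpace ℝ (Fin d)) :
    Matrix (Fin d) (Fin d) ℝ :=
  Matrix.of fun k l => scoreDeriv ρ x a (EuclideanSpace.single l 1) k

/-- `V_θ`, the expectation of `ψ̇(X - θ)` when `X` has law `μ`. -/
def meanJacobian {d : ℕ} (ρ : EuclideanSpace ℝ (Fin d) → ℝ)
    (μ : Measure (EuclideanSpace ℝ (Fin d))) (θ : EuclideanSpace ℝ (Fin d)) :
    Matrix (Fin d) (Fin d) ℝ :=
  Matrix.of fun k l => ∫ x, scoreJacobian ρ x θ k l ∂μ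

/-- `B_θ = E[ψ(X - θ) ψ(X - θ)ᵀ]` when `X` has law `μ`. -/
def scoreSecondMoment {d : ℕ} (ρ : EuclideanSpace ℝ (Fin d) → ℝ)
    (μ : Measure (EuclideanSpace ℝ (Fin d))) (θ : EuclideanSpace ℝ (Fin d)) :
    Matrix (Fin d) (Fin d) ℝ :=
  Matrix.of fun k l => ∫ x, score ρ x θ k * score ρ x θ l ∂μ

/-- `E[ψ(Y - θ) ψ(Z - θ)ᵀ]` for two random vectors `Y`, `Z`. -/
def scoreCrossMoment {d : ℕ} {Ω : Type*} [MeasurableSpace Ω] (P : Measure Ω)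
    (ρ : EuclideanSpace ℝ (Fin d) → ℝ) (θ : EuclideanSpace ℝ (Fin d))
    (Y Z : Ω → EuclideanSpace ℝ (Fin d)) : Matrix (Fin d) (Fin d) ℝ :=
  Matrix.of fun k l => ∫ ω, score ρ (Y ω) θ k * score ρ (Z ω) θ l ∂P

/-- The within-cluster term
`∑_{i ≤ n} ∑_j ∑_{j' ≠ j} w_{ij} w_{ij'} E[ψ(X_{ij} - θ) ψ(X_{ij'} - θ)ᵀ]`.
When all pairs in cluster `i` have the same law, the expectation in it is the matrix `C_i`. -/
def crossSum {d : ℕ} {Ω : Type*} [MeasurableSpace Ω] (P : Measure Ω)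
    (ρ : EuclideanSpace ℝ (Fin d) → ℝ) (θ : EuclideanSpace ℝ (Fin d))
    {m : ℕ → ℕ} (w : (i : ℕ) → Fin (m i) → ℝ)
    (X : (i : ℕ) → Fin (m i) → Ω → EuclideanSpace ℝ (Fin d)) (n : ℕ) :
    Matrix (Fin d) (Fin d) ℝ :=
  ∑ i ∈ Finset.range n, ∑ j, ∑ j' ∈ Finset.univ.erase j,
    (w i j * w i j') • scoreCrossMoment P ρ θ (X i j) (X i j')

/-- The weighted estimating function `∑_{i ≤ n} ∑_j w_{ij} ψ(X_{ij} - a)`. -/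
def weightedScore {d : ℕ} {Ω : Type*} (ρ : EuclideanSpace ℝ (Fin d) → ℝ)
    {m : ℕ → ℕ} (w : (i : ℕ) → Fin (m i) → ℝ)
    (X : (i : ℕ) → Fin (m i) → Ω → EuclideanSpace ℝ (Fin d)) (n : ℕ) (ω : Ω)
    (a : EuclideanSpace ℝ (Fin d)) : EuclideanSpace ℝ (Fin d) :=
  ∑ i ∈ Finset.range n, ∑ j, w i j • score ρ (X i j ω) a

/-- `Σ_θ^w = V_θ⁻¹ (c_w B_θ + C_θ^w) V_θ⁻¹`. -/
def asymptoticCov {d : ℕ} (ρ : EuclideanSpace ℝ (Fin d) → ℝ)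
    (μ : Measure (EuclideanSpace ℝ (Fin d))) (θ : EuclideanSpace ℝ (Fin d))
    (cw : ℝ) (Cw : Matrix (Fin d) (Fin d) ℝ) : Matrix (Fin d) (Fin d) ℝ :=
  (meanJacobian ρ μ θ)⁻¹ * (cw • scoreSecondMoment ρ μ θ + Cw) * (meanJacobian ρ μ θ)⁻¹

end ClusteredM

end

noncomputable section

namespace ClusteredM

/-! ### Kronecker's lemma and Kolmogorov's strong law of large numbers -/

/-! The estimator is a zero of the weighted score, so consistency is a law of large numbers combined
with compactness, and normality is a first order expansion at `θ`. The probability is done cluster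
by cluster: cluster sums are independent, and the dependence inside a cluster enters only through
moments, bounded by Jensen's inequality in `integrable_norm_clusterSum_rpow` or computed exactly in
`secondMoment_clusterScore`.

Consistency. The Hölder condition and the boundedness of `Θ` make the score Lipschitz in the
parameter, with a square integrable constant (`norm_score_sub_le`). Kolmogorov's law on a countable
dense subset of `Θ`, and for the Lipschitz constants, then forces every cluster point of the
estimator in the compact closure to be a zero of the mean score, hence to be `θ`
(`tendsto_zero_of_lipschitz`).

Normality. Write `S` for the weighted score at `θ`, `N` for the number of observations and `V` for
the mean Jacobian. Projection onto a fixed vector and Lyapunov's theorem give a Gaussian limit for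
`S/√N` (`tendsto_charFun_weightedScore`). The Hölder remainder and the law of large numbers for the
derivative give `V(θhat - θ) + S/N = o(θhat - θ)` almost surely (`isLittleO_linearization`). After
multiplication by `√N V⁻¹`, the vector `U = √N(θhat - θ)` differs from `W = -V⁻¹S/√N` by `o(U)`.
Such a relative error is harmless by `tendstoInDistribution_of_ae_isLittleO`, so no rate for the
estimator is needed beforehand. Finally `V` is a mean Hessian, hence symmetric, which makes the
sandwich covariance positive semidefinite. -/

lemma sum_range_succ_mul_eq (y : ℕ → ℝ) (n : ℕ) :
    ∑ k ∈ Finset.range n, ((k : ℝ) + 1) * y k =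
      n * ∑ k ∈ Finset.range n, y k - ∑ k ∈ Finset.range n, ∑ l ∈ Finset.range k, y l := by
  induction n with
  | zero => simp
  | succ n ih =>
    rw [Finset.sum_range_succ, ih, Finset.sum_range_succ (fun k => ∑ l ∈ Finset.range k, y l),
      Finset.sum_range_succ y]
    push_cast
    ring

/-- **Kronecker's lemma** for the normalizing sequence `n`. -/
lemma tendsto_inv_mul_sum_of_tendsto_sum_div {x : ℕ → ℝ} {s : ℝ}
    (h : Tendsto (fun n => ∑ k ∈ Finset.range n, x k / ((k : ℝ) + 1)) atTop (𝓝 s)) :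
    Tendsto (fun n : ℕ => (n : ℝ)⁻¹ * ∑ k ∈ Finset.range n, x k) atTop (𝓝 0) := by
  -- By Abel summation the average of `x` is the partial sum of the convergent series minus the
  -- Cesàro mean of those partial sums; both have limit `s`.
  have key := h.sub h.cesaro
  rw [sub_self] at key
  refine key.congr' ?_
  filter_upwards [eventually_gt_atTop 0] with n hn
  have hn' : (n : ℝ) ≠ 0 := by positivity
  have := sum_range_succ_mul_eq (fun k => x k / ((k : ℝ) + 1)) n
  have hx : ∀ k : ℕ, ((k : ℝ) + 1) * (x k / ((k : ℝ) + 1)) = x k := fun k => by field_simp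
  simp only [hx] at this
  rw [this]
  field_simp

variable {Ω : Type*} [MeasurableSpace Ω] {P : Measure Ω}

/-- A series of independent centered random variables with summable variances converges almost
surely. -/
theorem ae_exists_tendsto_sum_of_summable_variance [IsProbabilityMeasure P] {Z : ℕ → Ω → ℝ}
    (hmeas : ∀ i, Measurable (Z i)) (hindep : iIndepFun Z P) (hL2 : ∀ i, MemLp (Z i) 2 P)
    (hmean : ∀ i, ∫ ω, Z i ω ∂P = 0) (hsum : Summable fun i => ∫ ω, Z i ω ^ 2 ∂P) :
    ∀ᵐ ω ∂P, ∃ c, Tendsto (fun n => ∑ i ∈ Finset.range n, Z i ω) atTop (𝓝 c) := by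
  have hsm : ∀ i, StronglyMeasurable (Z i) := fun i => (hmeas i).stronglyMeasurable
  set ℱ := Filtration.natural Z hsm
  have hint : ∀ i, Integrable (Z i) P := fun i => (hL2 i).integrable (by norm_num)
  -- `S n` has `n + 1` terms: with only `n` of them the next increment would be `Z n`, already known
  -- at time `n`, and the martingale property would fail. The shift is undone at the end.
  let S : ℕ → Ω → ℝ := fun n => ∑ i ∈ Finset.range (n + 1), Z i
  have hadapt : StronglyAdapted ℱ S := by
    intro n
    refine Finset.stronglyMeasurable_sum _ fun i hi => ?_
    have hi' : i ≤ n := by simpa [Nat.lt_succ_iff] using hi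
    exact ((Filtration.stronglyAdapted_natural hsm) i).mono (ℱ.mono hi')
  have hSint : ∀ n, Integrable (S n) P := fun n => integrable_finsetSum' _ fun i _ => hint i
  have hmart : Martingale S ℱ P := by
    refine martingale_of_condExp_sub_eq_zero_nat hadapt hSint fun n => ?_
    have h1 : S (n + 1) - S n = Z (n + 1) := by
      simp only [S]
      rw [Finset.sum_range_succ _ (n + 1), add_sub_cancel_left]
    rw [h1]
    refine (iIndepFun.condExp_natural_ae_eq_of_lt hsm hindep (Nat.lt_succ_self n)).trans ?_
    filter_upwards with ω
    simp [hmean]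
  set V : ℝ := ∑' i, ∫ ω, Z i ω ^ 2 ∂P
  -- Independence makes variances add, and `|s| ≤ 1 + s²` turns the uniform second moment bound into
  -- the `L¹` bound that Doob's convergence theorem requires.
  have hbdd : ∀ n, eLpNorm (S n) 1 P ≤ (Real.toNNReal (1 + V) : NNReal) := by
    intro n
    have hSL2 : MemLp (S n) 2 P := memLp_finsetSum' _ fun i _ => hL2 i
    have hS0 : ∫ ω, S n ω ∂P = 0 := by
      simp only [S, Finset.sum_apply]
      rw [integral_finsetSum _ fun i _ => hint i]
      simp [hmean]
    have hvar : ∫ ω, S n ω ^ 2 ∂P ≤ V := by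
      have h1 : variance (S n) P = ∑ i ∈ Finset.range (n + 1), variance (Z i) P :=
        IndepFun.variance_sum (fun i _ => hL2 i) fun i _ j _ hij => hindep.indepFun hij
      rw [variance_of_integral_eq_zero hSL2.aemeasurable hS0] at h1
      rw [h1]
      have : ∀ i, variance (Z i) P = ∫ ω, Z i ω ^ 2 ∂P := fun i =>
        variance_of_integral_eq_zero (hL2 i).aemeasurable (hmean i)
      simp only [this]
      exact hsum.sum_le_tsum _ fun i _ => integral_nonneg fun ω => sq_nonneg _
    rw [eLpNorm_one_eq_lintegral_enorm, ← ofReal_integral_norm_eq_lintegral_enorm (hSint n)]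
    refine ENNReal.ofReal_le_ofReal ?_
    calc ∫ ω, ‖S n ω‖ ∂P ≤ ∫ ω, (1 + S n ω ^ 2) ∂P := by
          refine integral_mono (hSint n).norm ((integrable_const _).add hSL2.integrable_sq) ?_
          intro ω
          simp only [Real.norm_eq_abs]
          nlinarith [sq_nonneg (|S n ω| - 1), sq_abs (S n ω)]
      _ = 1 + ∫ ω, S n ω ^ 2 ∂P := by
          rw [integral_add (integrable_const _) hSL2.integrable_sq]; simp
      _ ≤ 1 + V := by linarith
  filter_upwards [hmart.submartingale.exists_ae_tendsto_of_bdd hbdd] with ω ⟨c, hc⟩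
  refine ⟨c, (tendsto_add_atTop_iff_nat 1).1 ?_⟩
  simpa [S] using hc

/-- **Kolmogorov's strong law of large numbers** for independent centered random variables. -/
theorem ae_tendsto_inv_mul_sum_of_summable_variance [IsProbabilityMeasure P] {Z : ℕ → Ω → ℝ}
    (hmeas : ∀ i, Measurable (Z i)) (hindep : iIndepFun Z P) (hL2 : ∀ i, MemLp (Z i) 2 P)
    (hmean : ∀ i, ∫ ω, Z i ω ∂P = 0)
    (hsum : Summable fun i : ℕ => (∫ ω, Z i ω ^ 2 ∂P) / ((i : ℝ) + 1) ^ 2) :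
    ∀ᵐ ω ∂P, Tendsto (fun n : ℕ => (n : ℝ)⁻¹ * ∑ i ∈ Finset.range n, Z i ω) atTop (𝓝 0) := by
  -- The rescaled variables `Z i / (i + 1)` have summable variances, and Kronecker's lemma converts
  -- their convergent series into averages of `Z`.
  have := ae_exists_tendsto_sum_of_summable_variance (P := P)
    (Z := fun i ω => Z i ω / ((i : ℝ) + 1)) (fun i => (hmeas i).div_const _)
    (hindep.comp (fun i x => x / ((i : ℝ) + 1)) fun i => measurable_id.div_const _)
    (fun i => by simpa only [div_eq_mul_inv] using (hL2 i).mul_const _)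
    (fun i => by rw [integral_div, hmean, zero_div])
    (by simpa only [div_pow, integral_div] using hsum)
  filter_upwards [this] with ω ⟨c, hc⟩
  exact tendsto_inv_mul_sum_of_tendsto_sum_div hc

/-! ### Lyapunov's central limit theorem -/

/-- Factors are exchanged one at a time; all the others lie in the closed unit disc, so each
exchange costs at most the distance of the two factors. -/
lemma norm_prod_sub_prod_le_sum {ι : Type*} (s : Finset ι) (a b : ι → ℂ)
    (ha : ∀ i ∈ s, ‖a i‖ ≤ 1) (hb : ∀ i ∈ s, ‖b i‖ ≤ 1) :
    ‖∏ i ∈ s, a i - ∏ i ∈ s, b i‖ ≤ ∑ i ∈ s, ‖a i - b i‖ := by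
  classical
  induction s using Finset.induction_on with
  | empty => simp
  | insert i s hi ih =>
    rw [Finset.prod_insert hi, Finset.prod_insert hi, Finset.sum_insert hi]
    have h1 : ‖∏ j ∈ s, a j‖ ≤ 1 := by
      rw [norm_prod]
      exact Finset.prod_le_one (fun _ _ => norm_nonneg _)
        fun j hj => ha j (Finset.mem_insert_of_mem hj)
    have h2 := ih (fun j hj => ha j (Finset.mem_insert_of_mem hj))
      fun j hj => hb j (Finset.mem_insert_of_mem hj)
    have h3 := hb i (Finset.mem_insert_self i s)
    calc ‖a i * ∏ j ∈ s, a j - b i * ∏ j ∈ s, b j‖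
        = ‖(a i - b i) * ∏ j ∈ s, a j + b i * (∏ j ∈ s, a j - ∏ j ∈ s, b j)‖ := by
          congr 1; ring
      _ ≤ ‖a i - b i‖ * ‖∏ j ∈ s, a j‖ + ‖b i‖ * ‖∏ j ∈ s, a j - ∏ j ∈ s, b j‖ := by
          refine (norm_add_le _ _).trans ?_
          rw [norm_mul, norm_mul]
      _ ≤ ‖a i - b i‖ * 1 + 1 * ∑ j ∈ s, ‖a j - b j‖ := by gcongr
      _ = _ := by ring

/-- Interpolates between the cubic Taylor remainder, used for `|x| ≤ 1`, and a quadratic bound, used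
for `|x| ≥ 1`. This is why a moment of some order above two, not necessarily three, is enough. -/
lemma norm_cexp_sub_taylor_two_le {p : ℝ} (hp : 2 ≤ p) (hp3 : p ≤ 3) (x : ℝ) :
    ‖Complex.exp (x * Complex.I) - (1 + x * Complex.I - (x : ℂ) ^ 2 / 2)‖ ≤ 3 * |x| ^ p := by
  have hdecomp : Complex.exp (x * Complex.I) - (1 + x * Complex.I - (x : ℂ) ^ 2 / 2) =
      ((Real.cos x - (1 - x ^ 2 / 2) : ℝ) : ℂ) + ((Real.sin x - x : ℝ) : ℂ) * Complex.I := by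
    rw [Complex.exp_mul_I]
    push_cast
    ring
  have hnorm : ‖Complex.exp (x * Complex.I) - (1 + x * Complex.I - (x : ℂ) ^ 2 / 2)‖ ≤
      |Real.cos x - (1 - x ^ 2 / 2)| + |Real.sin x - x| := by
    rw [hdecomp]
    refine (norm_add_le _ _).trans ?_
    rw [norm_mul, Complex.norm_I, mul_one, Complex.norm_real, Complex.norm_real]
    rfl
  refine hnorm.trans ?_
  rcases le_total |x| 1 with hx | hx
  · have h1 := Real.cos_bound hx
    have h2 : |Real.sin x - x| ≤ |x| ^ 3 / 6 := by
      rw [abs_sub_comm]; exact Real.abs_sub_sin_le x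
    have h3 : |x| ^ (3 : ℕ) ≤ |x| ^ p := by
      rcases eq_or_ne x 0 with rfl | h0
      · simp [Real.zero_rpow (by linarith : p ≠ 0)]
      · rw [← Real.rpow_natCast]
        exact Real.rpow_le_rpow_of_exponent_ge (by positivity) hx (by simpa using hp3)
    have h4 : |x| ^ 4 ≤ |x| ^ 3 := pow_le_pow_of_le_one (abs_nonneg _) hx (by norm_num)
    have : 0 ≤ |x| ^ 3 := by positivity
    linarith
  · have h1 : |Real.cos x - (1 - x ^ 2 / 2)| ≤ x ^ 2 / 2 := by
      rw [abs_of_nonneg (by linarith [Real.one_sub_sq_div_two_le_cos (x := x)])]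
      linarith [Real.cos_le_one x]
    have h2 : |Real.sin x - x| ≤ 2 * |x| := by
      refine (abs_sub _ _).trans ?_
      linarith [Real.abs_sin_le_one x]
    have h3 : |x| ^ (2 : ℕ) ≤ |x| ^ p := by
      rw [← Real.rpow_natCast]
      exact Real.rpow_le_rpow_of_exponent_le hx (by simpa using hp)
    rw [sq_abs] at h3
    nlinarith [sq_abs x]

/-- The same interpolation, between a quadratic and a linear bound. It is applied with `q = p / 2`
and `x` proportional to a variance. -/
lemma abs_exp_neg_sub_le {q : ℝ} (hq : 1 ≤ q) (hq2 : q ≤ 2) {x : ℝ} (hx : 0 ≤ x) :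
    |Real.exp (-x) - (1 - x)| ≤ x ^ q := by
  rcases le_total x 1 with h | h
  · have h1 := Real.abs_exp_sub_one_sub_id_le (x := -x) (by rwa [abs_neg, abs_of_nonneg hx])
    have h3 : x ^ (2 : ℕ) ≤ x ^ q := by
      rcases eq_or_lt_of_le hx with rfl | h0
      · simp [Real.zero_rpow (by linarith : q ≠ 0)]
      · rw [← Real.rpow_natCast]
        exact Real.rpow_le_rpow_of_exponent_ge h0 h (by simpa using hq2)
    calc |Real.exp (-x) - (1 - x)| = |Real.exp (-x) - 1 - -x| := by congr 1; ring
      _ ≤ (-x) ^ 2 := h1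
      _ = x ^ 2 := by ring
      _ ≤ _ := h3
  · have h1 : x ≤ x ^ q := by
      simpa using Real.rpow_le_rpow_of_exponent_le h hq
    have h2 := Real.add_one_le_exp (-x)
    rw [abs_of_nonneg (by linarith)]
    linarith [Real.exp_le_one_iff.2 (neg_nonpos.2 hx)]

lemma memLp_two_of_integrable_abs_rpow [IsFiniteMeasure P] {Z : Ω → ℝ} (hZ : AEMeasurable Z P)
    {p : ℝ} (hp : 2 ≤ p) (hint : Integrable (fun ω => |Z ω| ^ p) P) : MemLp Z 2 P := by
  rw [memLp_two_iff_integrable_sq hZ.aestronglyMeasurable]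
  refine ((integrable_const (1 : ℝ)).add hint).mono' (hZ.pow_const 2).aestronglyMeasurable ?_
  filter_upwards with ω
  rw [Real.norm_eq_abs, abs_of_nonneg (sq_nonneg _), ← sq_abs, Pi.add_apply]
  rcases le_total |Z ω| 1 with h | h
  · have : |Z ω| ^ 2 ≤ 1 := pow_le_one₀ (abs_nonneg _) h
    have h0 : 0 ≤ |Z ω| ^ p := by positivity
    linarith
  · have := Real.rpow_le_rpow_of_exponent_le h hp
    rw [Real.rpow_two] at this
    linarith

/-- Quantitative comparison of a characteristic function with the Gaussian one. -/
lemma norm_charFun_sub_exp_le [IsProbabilityMeasure P] {Z : Ω → ℝ} (hZ : Measurable Z)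
    (hmean : ∫ ω, Z ω ∂P = 0) {p : ℝ} (hp : 2 ≤ p) (hp3 : p ≤ 3)
    (hint : Integrable (fun ω => |Z ω| ^ p) P) (t : ℝ) :
    ‖charFun (P.map Z) t - Complex.exp (-(t ^ 2 * (∫ ω, Z ω ^ 2 ∂P) / 2) : ℝ)‖ ≤
      4 * (|t| ^ p * ∫ ω, |Z ω| ^ p ∂P) := by
  have hL2 := memLp_two_of_integrable_abs_rpow hZ.aemeasurable hp hint
  have hI2 := hL2.integrable_sq
  have hI1 : Integrable Z P := hL2.integrable (by norm_num)
  set v := ∫ ω, Z ω ^ 2 ∂P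
  have hv : 0 ≤ v := integral_nonneg fun ω => sq_nonneg _
  have habs : ∀ ω, |t * Z ω| ^ p = |t| ^ p * |Z ω| ^ p := fun ω => by
    rw [abs_mul, Real.mul_rpow (abs_nonneg _) (abs_nonneg _)]
  have hA : ‖charFun (P.map Z) t - ((1 - t ^ 2 * v / 2 : ℝ) : ℂ)‖ ≤
      3 * (|t| ^ p * ∫ ω, |Z ω| ^ p ∂P) := by
    have e1 : charFun (P.map Z) t = ∫ ω, Complex.exp (((t * Z ω : ℝ) : ℂ) * Complex.I) ∂P := by
      rw [charFun_apply_real, integral_map hZ.aemeasurable (by fun_prop)]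
      push_cast
      rfl
    have iL : Integrable (fun ω => ((t * Z ω : ℝ) : ℂ) * Complex.I) P :=
      (hI1.const_mul t).ofReal.mul_const _
    have iQ : Integrable (fun ω => ((t * Z ω : ℝ) : ℂ) ^ 2 / 2) P := by
      have : Integrable (fun ω => (((t ^ 2 * Z ω ^ 2 / 2 : ℝ)) : ℂ)) P :=
        ((hI2.const_mul (t ^ 2)).div_const 2).ofReal
      refine this.congr (ae_of_all _ fun ω => ?_)
      push_cast
      ring
    have iS : Integrable (fun ω => 1 + ((t * Z ω : ℝ) : ℂ) * Complex.I) P :=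
      (integrable_const 1).add iL
    have iT : Integrable (fun ω => 1 + ((t * Z ω : ℝ) : ℂ) * Complex.I
        - ((t * Z ω : ℝ) : ℂ) ^ 2 / 2) P := iS.sub iQ
    have iE : Integrable (fun ω => Complex.exp (((t * Z ω : ℝ) : ℂ) * Complex.I)) P := by
      refine (integrable_const (1 : ℝ)).mono' (by fun_prop) (ae_of_all _ fun ω => ?_)
      rw [Complex.norm_exp_ofReal_mul_I]
    have e2 : ((1 - t ^ 2 * v / 2 : ℝ) : ℂ) = ∫ ω, (1 + ((t * Z ω : ℝ) : ℂ) * Complex.I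
        - ((t * Z ω : ℝ) : ℂ) ^ 2 / 2) ∂P := by
      have hq : ∫ ω, ((t * Z ω : ℝ) : ℂ) ^ 2 / 2 ∂P = ((t ^ 2 * v / 2 : ℝ) : ℂ) := by
        have : ∀ ω, ((t * Z ω : ℝ) : ℂ) ^ 2 / 2 = ((t ^ 2 * Z ω ^ 2 / 2 : ℝ) : ℂ) := fun ω => by
          push_cast; ring
        simp only [this]
        rw [integral_complex_ofReal, integral_div, integral_const_mul]
      have hl : ∫ ω, ((t * Z ω : ℝ) : ℂ) * Complex.I ∂P = 0 := by
        rw [integral_mul_const, integral_complex_ofReal, integral_const_mul, hmean]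
        simp
      rw [integral_sub iS iQ, integral_add (integrable_const 1) iL,
        hq, hl]
      simp
    rw [e1, e2, ← integral_sub iE iT, ← integral_const_mul, ← integral_const_mul]
    refine norm_integral_le_of_norm_le ((hint.const_mul _).const_mul _) (ae_of_all _ fun ω => ?_)
    rw [← habs]
    exact norm_cexp_sub_taylor_two_le hp hp3 _
  have hB : ‖((1 - t ^ 2 * v / 2 : ℝ) : ℂ) - Complex.exp (-(t ^ 2 * v / 2) : ℝ)‖ ≤
      |t| ^ p * ∫ ω, |Z ω| ^ p ∂P := by
    rw [← Complex.ofReal_exp, ← Complex.ofReal_sub, Complex.norm_real, norm_sub_rev,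
      Real.norm_eq_abs]
    refine (abs_exp_neg_sub_le (q := p / 2) (by linarith) (by linarith) (by positivity)).trans ?_
    -- Jensen's inequality lets the error on the Gaussian side be measured by the same `p`-th moment
    -- as the error on the side of `Z`.
    have hjensen : v ^ (p / 2) ≤ ∫ ω, |Z ω| ^ p ∂P := by
      have hpow : ∀ ω, (Z ω ^ 2) ^ (p / 2) = |Z ω| ^ p := fun ω => by
        rw [← sq_abs, ← Real.rpow_natCast, ← Real.rpow_mul (abs_nonneg _)]
        congr 1
        push_cast
        ring
      have := (convexOn_rpow (p := p / 2) (by linarith)).map_integral_le (μ := P)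
        (f := fun ω => Z ω ^ 2)
        (Real.continuous_rpow_const (by linarith : 0 ≤ p / 2)).continuousOn isClosed_Ici
        (ae_of_all _ fun ω => sq_nonneg (Z ω)) hI2 (by simpa only [Function.comp_def, hpow])
      simpa only [hpow] using this
    have ht : (t ^ 2) ^ (p / 2) = |t| ^ p := by
      rw [← sq_abs, ← Real.rpow_natCast, ← Real.rpow_mul (abs_nonneg _)]
      congr 1
      push_cast
      ring
    calc (t ^ 2 * v / 2) ^ (p / 2) ≤ (t ^ 2 * v) ^ (p / 2) := by
          refine Real.rpow_le_rpow (by positivity) ?_ (by linarith)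
          have : 0 ≤ t ^ 2 * v := by positivity
          linarith
      _ = |t| ^ p * v ^ (p / 2) := by rw [Real.mul_rpow (sq_nonneg _) hv, ht]
      _ ≤ _ := by gcongr
  calc _ ≤ _ := norm_sub_le_norm_sub_add_norm_sub _ ((1 - t ^ 2 * v / 2 : ℝ) : ℂ) _
    _ ≤ _ := add_le_add hA hB
    _ = _ := by ring

/-- **Lyapunov's central limit theorem**, in terms of characteristic functions. -/
theorem tendsto_charFun_of_lyapunov [IsProbabilityMeasure P] {Z : ℕ → Ω → ℝ}
    (hmeas : ∀ i, Measurable (Z i)) (hindep : iIndepFun Z P) (hmean : ∀ i, ∫ ω, Z i ω ∂P = 0)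
    {p : ℝ} (hp : 2 < p) (hp3 : p ≤ 3) (hint : ∀ i, Integrable (fun ω => |Z i ω| ^ p) P)
    {N : ℕ → ℝ} (hN : Tendsto N atTop atTop) {v : ℝ}
    (hv : Tendsto (fun n => (∑ i ∈ Finset.range n, ∫ ω, Z i ω ^ 2 ∂P) / N n) atTop (𝓝 v))
    {B : ℝ} (hB : ∀ᶠ n in atTop, ∑ i ∈ Finset.range n, ∫ ω, |Z i ω| ^ p ∂P ≤ B * N n) :
    Tendsto (fun n => charFun (P.map fun ω => ∑ i ∈ Finset.range n, Z i ω) (√(N n))⁻¹) atTop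
      (𝓝 (Complex.exp (-(v / 2) : ℝ))) := by
  -- The comparison is with the Gaussian of the exact variance at stage `n`, which factors over the
  -- summands; only afterwards does the variance tend to `v`.
  have hgauss : Tendsto (fun n => Complex.exp
      (-((∑ i ∈ Finset.range n, ∫ ω, Z i ω ^ 2 ∂P) / N n / 2) : ℝ)) atTop
      (𝓝 (Complex.exp (-(v / 2) : ℝ))) := by
    have hc : Continuous fun x : ℝ => Complex.exp (-(x / 2) : ℝ) := by fun_prop
    exact (hc.tendsto v).comp hv
  refine tendsto_of_tendsto_of_dist hgauss ?_
  -- Each summand contributes `N^(-p/2)` times its `p`-th moment, and these moments sum to at most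
  -- `B N`; the resulting power of `N` is negative because `p > 2`.
  have hrate : Tendsto (fun n => 4 * B * (N n) ^ (-(p / 2 - 1))) atTop (𝓝 0) := by
    have := ((tendsto_rpow_neg_atTop (by linarith : 0 < p / 2 - 1)).comp hN).const_mul (4 * B)
    simpa using this
  refine squeeze_zero' (Eventually.of_forall fun n => dist_nonneg) ?_ hrate
  filter_upwards [hB, hN.eventually_gt_atTop 0] with n hBn hNn
  have hchar : charFun (P.map fun ω => ∑ i ∈ Finset.range n, Z i ω) (√(N n))⁻¹ =
      ∏ i ∈ Finset.range n, charFun (P.map (Z i)) (√(N n))⁻¹ := by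
    rw [iIndepFun.charFun_map_fun_finsetSum_eq_prod (fun i _ => (hmeas i).aemeasurable)
      (hindep.restrict _), Finset.prod_apply]
  have ht2 : ((√(N n))⁻¹) ^ 2 = (N n)⁻¹ := by rw [inv_pow, Real.sq_sqrt hNn.le]
  have hexp : Complex.exp (-((∑ i ∈ Finset.range n, ∫ ω, Z i ω ^ 2 ∂P) / N n / 2) : ℝ) =
      ∏ i ∈ Finset.range n,
        Complex.exp (-(((√(N n))⁻¹) ^ 2 * (∫ ω, Z i ω ^ 2 ∂P) / 2) : ℝ) := by
    rw [← Complex.exp_sum, ← Complex.ofReal_sum, Finset.sum_neg_distrib, ← Finset.sum_div,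
      ← Finset.mul_sum, ht2]
    congr 3
    ring
  rw [dist_comm, dist_eq_norm, hchar, hexp]
  refine (norm_prod_sub_prod_le_sum _ _ _ (fun i _ => ?_) fun i _ => ?_).trans ?_
  · have := Measure.isProbabilityMeasure_map (μ := P) (hmeas i).aemeasurable
    exact norm_charFun_le_one _
  · rw [Complex.norm_exp_ofReal, Real.exp_le_one_iff]
    have : 0 ≤ ∫ ω, Z i ω ^ 2 ∂P := integral_nonneg fun ω => sq_nonneg _
    have : 0 ≤ ((√(N n))⁻¹) ^ 2 * (∫ ω, Z i ω ^ 2 ∂P) := by positivity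
    linarith
  · have htp : |(√(N n))⁻¹| ^ p = (N n) ^ (-(p / 2)) := by
      rw [abs_of_nonneg (by positivity), Real.sqrt_eq_rpow, ← Real.rpow_neg hNn.le,
        ← Real.rpow_mul hNn.le]
      congr 1
      ring
    calc _ ≤ ∑ i ∈ Finset.range n, 4 * (|(√(N n))⁻¹| ^ p * ∫ ω, |Z i ω| ^ p ∂P) :=
          Finset.sum_le_sum fun i _ =>
            norm_charFun_sub_exp_le (hmeas i) (hmean i) hp.le hp3 (hint i) _
      _ = 4 * ((N n) ^ (-(p / 2)) * ∑ i ∈ Finset.range n, ∫ ω, |Z i ω| ^ p ∂P) := by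
          rw [← Finset.mul_sum, ← Finset.mul_sum, htp]
      _ ≤ 4 * ((N n) ^ (-(p / 2)) * (B * N n)) := by gcongr
      _ = 4 * B * ((N n) ^ (-(p / 2)) * (N n) ^ (1 : ℝ)) := by rw [Real.rpow_one]; ring
      _ = 4 * B * (N n) ^ (-(p / 2 - 1)) := by
          rw [← Real.rpow_add hNn]; congr 2; ring

/-! ### Asymptotically equivalent sequences of random vectors -/

/-- If `U n - W n = o(U n)` almost surely and `W n` converges in distribution, then `U n` has the
same limit in distribution. -/
theorem tendstoInDistribution_of_ae_isLittleO {E Ω' : Type*} [NormedAddCommGroup E]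
    [NormedSpace ℝ E] [SecondCountableTopology E] [MeasurableSpace E] [BorelSpace E]
    [MeasurableSpace Ω'] {Q : Measure Ω'} [IsProbabilityMeasure Q] [IsProbabilityMeasure P]
    {U W : ℕ → Ω → E} {Z : Ω' → E} (hU : ∀ n, AEMeasurable (U n) P)
    (hUW : ∀ᵐ ω ∂P, (fun n => U n ω - W n ω) =o[atTop] fun n => U n ω)
    (hW : TendstoInDistribution W atTop Z (fun _ => P) Q) :
    TendstoInDistribution U atTop Z (fun _ => P) Q := by
  have hWm := hW.forall_aemeasurable
  -- An error negligible relative to `U` is negligible relative to `W`, whose limit law is known.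
  have hUW' : ∀ᵐ ω ∂P, (fun n => U n ω - W n ω) =o[atTop] fun n => W n ω := by
    filter_upwards [hUW] with ω h
    refine h.trans_isBigO ?_
    simpa using h.right_isBigO_sub
  -- The relative error tends to zero, so Slutsky's theorem applies to the continuous map `(x, y) ↦
  -- x + ‖x‖ y`. Where `W n` vanishes the inverse is `0`, and so is `e n`.
  let e : ℕ → Ω → E := fun n ω => ‖W n ω‖⁻¹ • (U n ω - W n ω)
  have hem : ∀ n, AEMeasurable (e n) P := fun n => (hWm n).norm.inv.smul ((hU n).sub (hWm n))
  have he : ∀ᵐ ω ∂P, Tendsto (fun n => e n ω) atTop (𝓝 0) := by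
    filter_upwards [hUW'] with ω h
    rw [tendsto_zero_iff_norm_tendsto_zero]
    refine h.norm_norm.tendsto_div_nhds_zero.congr fun n => ?_
    simp only [e]
    rw [norm_smul, norm_inv, norm_norm, div_eq_inv_mul]
  have h1 := hW.continuous_comp_prodMk_of_tendstoInMeasure_const
    (g := fun x : E × E => x.1 + ‖x.1‖ • x.2) (by fun_prop)
    (tendstoInMeasure_of_tendsto_ae (fun n => (hem n).aestronglyMeasurable) he) hem
  simp only [smul_zero, add_zero] at h1
  refine tendstoInDistribution_of_tendstoInMeasure_sub U Z h1 ?_ hU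
  refine tendstoInMeasure_of_tendsto_ae
    (fun n => ((hU n).sub (h1.forall_aemeasurable n)).aestronglyMeasurable) ?_
  filter_upwards [hUW'] with ω h
  -- Where `W n` vanishes, `W + ‖W‖ e` carries no information on `U`, but the little-o bound then
  -- forces `U n = W n` for large `n`.
  have h2 : ∀ᶠ n in atTop, W n ω = 0 → U n ω - W n ω = 0 := by
    filter_upwards [h.def one_pos] with n hn h0
    rw [h0, norm_zero, mul_zero] at hn
    simpa [h0] using hn
  refine tendsto_const_nhds.congr' ?_
  filter_upwards [h2] with n hn
  simp only [Pi.sub_apply, Pi.zero_apply, e]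
  rcases eq_or_ne (W n ω) 0 with h0 | h0
  · have := hn h0
    rw [h0, sub_zero] at this
    simp [h0, this]
  · rw [smul_smul, mul_inv_cancel₀ (norm_ne_zero_iff.2 h0), one_smul]
    abel

/-! ### The score and its derivative -/

section Score

variable {d : ℕ} {ρ : EuclideanSpace ℝ (Fin d) → ℝ}

/-- Makes the score a function of `x - a` alone, so that regularity in the parameter yields
continuity and measurability in the observation. -/
lemma score_eq_neg_gradient (hρ : Differentiable ℝ ρ) (x a : EuclideanSpace ℝ (Fin d)) :
    score ρ x a = -gradient ρ (x - a) := by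
  have h : HasFDerivAt (fun b => ρ (x - b)) (-fderiv ℝ ρ (x - a)) a := by
    have h1 := (hρ (x - a)).hasFDerivAt.comp a ((hasFDerivAt_id a).const_sub x)
    refine h1.congr_fderiv ?_
    ext v
    simp
  rw [score, gradient, h.fderiv, map_neg, gradient]

lemma differentiable_gradient (hρ : Differentiable ℝ ρ)
    (hψ : ∀ x, Differentiable ℝ (score ρ x)) : Differentiable ℝ (gradient ρ) := by
  have h : gradient ρ = fun y => -score ρ 0 (-y) := by
    ext1 y
    rw [score_eq_neg_gradient hρ, zero_sub, neg_neg, neg_neg]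
  rw [h]
  exact ((hψ 0).comp differentiable_id.neg).neg

lemma continuous_score_left (hρ : Differentiable ℝ ρ) (hψ : ∀ x, Differentiable ℝ (score ρ x))
    (a : EuclideanSpace ℝ (Fin d)) : Continuous fun x => score ρ x a := by
  simp only [score_eq_neg_gradient hρ]
  exact ((differentiable_gradient hρ hψ).continuous.comp (continuous_id.sub continuous_const)).neg

lemma scoreDeriv_eq_fderiv_gradient (hρ : Differentiable ℝ ρ)
    (hψ : ∀ x, Differentiable ℝ (score ρ x)) (x a : EuclideanSpace ℝ (Fin d)) :
    scoreDeriv ρ x a = fderiv ℝ (gradient ρ) (x - a) := by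
  have h1 : score ρ x = fun b => -gradient ρ (x - b) := by
    ext1 b
    exact score_eq_neg_gradient hρ x b
  have h2 := ((differentiable_gradient hρ hψ (x - a)).hasFDerivAt.comp a
    ((hasFDerivAt_id a).const_sub x)).neg
  rw [scoreDeriv, h1]
  refine (h2.congr_fderiv ?_).fderiv
  ext v
  simp

/-- Continuity of the derivative in `x` is not needed: a derivative is always Borel measurable here.
-/
lemma measurable_scoreDeriv_left (hρ : Differentiable ℝ ρ)
    (hψ : ∀ x, Differentiable ℝ (score ρ x)) (a : EuclideanSpace ℝ (Fin d)) :
    Measurable fun x => scoreDeriv ρ x a := by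
  simp only [scoreDeriv_eq_fderiv_gradient hρ hψ]
  exact (measurable_fderiv ℝ (gradient ρ)).comp (measurable_id.sub_const a)

lemma measurable_scoreJacobian_left (hρ : Differentiable ℝ ρ)
    (hψ : ∀ x, Differentiable ℝ (score ρ x)) (a : EuclideanSpace ℝ (Fin d)) (k l : Fin d) :
    Measurable fun x => scoreJacobian ρ x a k l := by
  have h := (measurable_scoreDeriv_left hρ hψ a).apply_continuousLinearMap
    (EuclideanSpace.single l (1 : ℝ))
  exact (EuclideanSpace.proj (𝕜 := ℝ) k).continuous.measurable.comp h

/-- The derivative of the score is a Hessian, and second derivatives are symmetric. This is the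
source of the symmetry of `V`. -/
lemma inner_scoreDeriv_comm (hρ : Differentiable ℝ ρ) (hψ : ∀ x, Differentiable ℝ (score ρ x))
    (x a u v : EuclideanSpace ℝ (Fin d)) :
    inner ℝ (scoreDeriv ρ x a u) v = inner ℝ (scoreDeriv ρ x a v) u := by
  have h1 : ∀ b, HasFDerivAt (fun b => ρ (x - b)) (innerSL ℝ (score ρ x b)) b := by
    intro b
    have hd : DifferentiableAt ℝ (fun b => ρ (x - b)) b :=
      (hρ (x - b)).comp b (differentiableAt_id.const_sub x)
    exact hd.hasGradientAt.hasFDerivAt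
  have h2 : HasFDerivAt (fun b => innerSL ℝ (score ρ x b))
      ((innerSL ℝ).comp (scoreDeriv ρ x a)) a :=
    (innerSL ℝ).hasFDerivAt.comp a (hψ x a).hasFDerivAt
  simpa using second_derivative_symmetric h1 h2 u v

lemma scoreJacobian_eq_inner (x a : EuclideanSpace ℝ (Fin d)) (k l : Fin d) :
    scoreJacobian ρ x a k l =
      inner ℝ (scoreDeriv ρ x a (EuclideanSpace.single l 1)) (EuclideanSpace.single k 1) := by
  rw [EuclideanSpace.inner_single_right]
  simp [scoreJacobian]

lemma scoreJacobian_comm (hρ : Differentiable ℝ ρ) (hψ : ∀ x, Differentiable ℝ (score ρ x))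
    (x a : EuclideanSpace ℝ (Fin d)) (k l : Fin d) :
    scoreJacobian ρ x a k l = scoreJacobian ρ x a l k := by
  rw [scoreJacobian_eq_inner, scoreJacobian_eq_inner, inner_scoreDeriv_comm hρ hψ]

lemma meanJacobian_transpose (hρ : Differentiable ℝ ρ) (hψ : ∀ x, Differentiable ℝ (score ρ x))
    (μ : Measure (EuclideanSpace ℝ (Fin d))) (a : EuclideanSpace ℝ (Fin d)) :
    (meanJacobian ρ μ a).transpose = meanJacobian ρ μ a := by
  ext k l
  simp only [meanJacobian, Matrix.transpose_apply, Matrix.of_apply]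
  simp only [scoreJacobian_comm hρ hψ _ _ l k]

lemma scoreDeriv_eq_toEuclideanCLM (x a : EuclideanSpace ℝ (Fin d)) :
    scoreDeriv ρ x a = Matrix.toEuclideanCLM (𝕜 := ℝ) (scoreJacobian ρ x a) := by
  refine ContinuousLinearMap.coe_injective ?_
  refine (EuclideanSpace.basisFun (Fin d) ℝ).toBasis.ext fun l => ?_
  ext k
  simp [scoreJacobian]

/-- Expansion in matrix units; it transfers integrability of the entries to the operator norm. -/
lemma norm_scoreDeriv_le (x a : EuclideanSpace ℝ (Fin d)) :
    ‖scoreDeriv ρ x a‖ ≤ ∑ k, ∑ l, |scoreJacobian ρ x a k l| *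
      ‖Matrix.toEuclideanCLM (𝕜 := ℝ) (Matrix.single k l (1 : ℝ))‖ := by
  have h : scoreDeriv ρ x a = ∑ k, ∑ l, scoreJacobian ρ x a k l •
      Matrix.toEuclideanCLM (𝕜 := ℝ) (Matrix.single k l (1 : ℝ)) := by
    rw [scoreDeriv_eq_toEuclideanCLM]
    conv_lhs => rw [Matrix.matrix_eq_sum_single (scoreJacobian ρ x a)]
    simp only [map_sum, ← map_smul, Matrix.smul_single, smul_eq_mul, mul_one]
  rw [h]
  refine (norm_sum_le _ _).trans (Finset.sum_le_sum fun k _ => (norm_sum_le _ _).trans ?_)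
  refine Finset.sum_le_sum fun l _ => ?_
  rw [norm_smul, Real.norm_eq_abs]

lemma memLp_norm_scoreDeriv (hρ : Differentiable ℝ ρ) (hψ : ∀ x, Differentiable ℝ (score ρ x))
    {μ : Measure (EuclideanSpace ℝ (Fin d))} {θ : EuclideanSpace ℝ (Fin d)}
    (hψsq : ∀ k l, Integrable (fun x => scoreJacobian ρ x θ k l ^ 2) μ) :
    MemLp (fun x => ‖scoreDeriv ρ x θ‖) 2 μ := by
  have hJ : ∀ k l, MemLp (fun x => scoreJacobian ρ x θ k l) 2 μ := fun k l =>
    (memLp_two_iff_integrable_sq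
      (measurable_scoreJacobian_left hρ hψ θ k l).aestronglyMeasurable).2 (hψsq k l)
  have hsum : MemLp (fun x => ∑ k, ∑ l, |scoreJacobian ρ x θ k l| *
      ‖Matrix.toEuclideanCLM (𝕜 := ℝ) (Matrix.single k l (1 : ℝ))‖) 2 μ :=
    memLp_finsetSum _ fun k _ => memLp_finsetSum _ fun l _ => (hJ k l).norm.mul_const _
  refine hsum.mono (measurable_scoreDeriv_left hρ hψ θ).norm.aestronglyMeasurable
    (ae_of_all _ fun x => ?_)
  rw [norm_norm]
  exact (norm_scoreDeriv_le x θ).trans (le_abs_self _)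

variable {Θ : Set (EuclideanSpace ℝ (Fin d))} {θ : EuclideanSpace ℝ (Fin d)} {K lam : ℝ}

/-- First order expansion of the score with a uniform Hölder remainder. -/
lemma norm_score_sub_sub_le (hΘ : Convex ℝ Θ) (hθ : θ ∈ Θ)
    (hψ : ∀ x, Differentiable ℝ (score ρ x)) (hlam : 0 < lam)
    (hHolder : ∀ x, ∀ a ∈ Θ, ∀ b ∈ Θ,
      ‖scoreDeriv ρ x a - scoreDeriv ρ x b‖ ≤ K * ‖a - b‖ ^ lam)
    (x : EuclideanSpace ℝ (Fin d)) {a : EuclideanSpace ℝ (Fin d)} (ha : a ∈ Θ) :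
    ‖score ρ x a - score ρ x θ - scoreDeriv ρ x θ (a - θ)‖ ≤
      |K| * ‖a - θ‖ ^ lam * ‖a - θ‖ := by
  -- The mean value inequality is used on the segment and not on `Θ`, because there `‖b - θ‖ ≤ ‖a -
  -- θ‖`, which makes the remainder of order `1 + lam`.
  refine (convex_segment θ a).norm_image_sub_le_of_norm_fderiv_le' (𝕜 := ℝ)
    (fun b _ => hψ x b) (fun b hb => ?_) (left_mem_segment ℝ θ a) (right_mem_segment ℝ θ a)
  refine (hHolder x b (hΘ.segment_subset hθ ha hb) θ hθ).trans ?_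
  have h1 : ‖b - θ‖ ≤ ‖a - θ‖ := by
    obtain ⟨t, ⟨ht0, ht1⟩, rfl⟩ := (segment_eq_image' ℝ θ a ▸ hb)
    simp only [add_sub_cancel_left, norm_smul, Real.norm_eq_abs, abs_of_nonneg ht0]
    exact mul_le_of_le_one_left (norm_nonneg _) ht1
  gcongr
  exact le_abs_self K

/-- On a set of diameter at most `D` the Hölder condition bounds the derivative by its value at `θ`
plus a constant. Continuity extends the Lipschitz bound to the closure, where cluster points of the
estimator lie. -/
lemma norm_score_sub_le (hΘ : Convex ℝ Θ) (hθ : θ ∈ Θ)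
    (hψ : ∀ x, Differentiable ℝ (score ρ x)) (hlam : 0 < lam)
    (hHolder : ∀ x, ∀ a ∈ Θ, ∀ b ∈ Θ,
      ‖scoreDeriv ρ x a - scoreDeriv ρ x b‖ ≤ K * ‖a - b‖ ^ lam)
    {D : ℝ} (hD : ∀ a ∈ Θ, ∀ b ∈ Θ, ‖a - b‖ ≤ D)
    (x : EuclideanSpace ℝ (Fin d)) {a b : EuclideanSpace ℝ (Fin d)}
    (ha : a ∈ closure Θ) (hb : b ∈ closure Θ) :
    ‖score ρ x a - score ρ x b‖ ≤ (‖scoreDeriv ρ x θ‖ + |K| * D ^ lam) * ‖a - b‖ := by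
  have hD0 : 0 ≤ D := (norm_nonneg _).trans (hD θ hθ θ hθ)
  have hlip : LipschitzOnWith (Real.toNNReal (‖scoreDeriv ρ x θ‖ + |K| * D ^ lam))
      (score ρ x) Θ := by
    refine hΘ.lipschitzOnWith_of_nnnorm_fderiv_le (𝕜 := ℝ) (fun b _ => hψ x b) fun b hb => ?_
    rw [← NNReal.coe_le_coe, coe_nnnorm, Real.coe_toNNReal _ (by positivity)]
    change ‖scoreDeriv ρ x b‖ ≤ _
    have h1 := hHolder x b hb θ hθ
    have h2 : K * ‖b - θ‖ ^ lam ≤ |K| * D ^ lam := by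
      gcongr
      · exact le_abs_self K
      · exact hD b hb θ hθ
    have h3 := norm_le_norm_add_norm_sub' (scoreDeriv ρ x b) (scoreDeriv ρ x θ)
    linarith
  have := (lipschitzOnWith_closure_iff (hψ x).continuous.continuousOn).2 hlip
  simpa [Real.coe_toNNReal _ (by positivity : 0 ≤ ‖scoreDeriv ρ x θ‖ + |K| * D ^ lam)]
    using this.norm_sub_le ha hb

lemma memLp_score (hΘ : Convex ℝ Θ) (hθ : θ ∈ Θ) (hρ : Differentiable ℝ ρ)
    (hψ : ∀ x, Differentiable ℝ (score ρ x)) (hlam : 0 < lam)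
    (hHolder : ∀ x, ∀ a ∈ Θ, ∀ b ∈ Θ,
      ‖scoreDeriv ρ x a - scoreDeriv ρ x b‖ ≤ K * ‖a - b‖ ^ lam)
    {D : ℝ} (hD : ∀ a ∈ Θ, ∀ b ∈ Θ, ‖a - b‖ ≤ D)
    {μ : Measure (EuclideanSpace ℝ (Fin d))} [IsFiniteMeasure μ]
    (hψsq : ∀ k l, Integrable (fun x => scoreJacobian ρ x θ k l ^ 2) μ)
    (hsc : MemLp (fun x => score ρ x θ) 2 μ)
    {a : EuclideanSpace ℝ (Fin d)} (ha : a ∈ closure Θ) :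
    MemLp (fun x => score ρ x a) 2 μ := by
  have h1 : MemLp (fun x => (‖scoreDeriv ρ x θ‖ + |K| * D ^ lam) * ‖a - θ‖ + ‖score ρ x θ‖) 2 μ :=
    (((memLp_norm_scoreDeriv hρ hψ hψsq).add (memLp_const _)).mul_const _).add hsc.norm
  refine h1.mono (continuous_score_left hρ hψ a).aestronglyMeasurable (ae_of_all _ fun x => ?_)
  have h2 := norm_score_sub_le hΘ hθ hψ hlam hHolder hD x ha (subset_closure hθ)
  have h3 := norm_le_norm_add_norm_sub' (score ρ x a) (score ρ x θ)
  refine le_trans ?_ (le_abs_self _)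
  linarith

end Score

/-! ### Sums over clusters -/

/-- Jensen's inequality for the normalized weights, with the denominators cleared. -/
lemma sum_mul_rpow_le {ι : Type*} (s : Finset ι) (w z : ι → ℝ) (hw : ∀ i ∈ s, 0 ≤ w i)
    (hz : ∀ i ∈ s, 0 ≤ z i) (hW : 0 < ∑ i ∈ s, w i) {p : ℝ} (hp : 1 ≤ p) :
    (∑ i ∈ s, w i * z i) ^ p ≤ (∑ i ∈ s, w i) ^ (p - 1) * ∑ i ∈ s, w i * z i ^ p := by
  set W := ∑ i ∈ s, w i
  have h := Real.rpow_arith_mean_le_arith_mean_rpow s (fun i => w i / W) z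
    (fun i hi => div_nonneg (hw i hi) hW.le) (by rw [← Finset.sum_div, div_self hW.ne']) hz hp
  have e1 : ∀ y : ι → ℝ, ∑ i ∈ s, w i / W * y i = (∑ i ∈ s, w i * y i) / W := fun y => by
    rw [Finset.sum_div]
    exact Finset.sum_congr rfl fun i _ => by ring
  rw [e1, e1, Real.div_rpow (Finset.sum_nonneg fun i hi => mul_nonneg (hw i hi) (hz i hi)) hW.le,
    div_le_div_iff₀ (by positivity) hW] at h
  rw [Real.rpow_sub hW, Real.rpow_one, div_mul_eq_mul_div, le_div_iff₀ hW]
  linarith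

lemma le_totalSize {m : ℕ → ℕ} (hm : ∀ i, 1 ≤ m i) (n : ℕ) : n ≤ totalSize m n := by
  simpa [totalSize] using Finset.sum_le_sum fun i (_ : i ∈ Finset.range n) => hm i

lemma tendsto_totalSize {m : ℕ → ℕ} (hm : ∀ i, 1 ≤ m i) :
    Tendsto (fun n => (totalSize m n : ℝ)) atTop atTop :=
  tendsto_natCast_atTop_atTop.comp (tendsto_atTop_mono (le_totalSize hm) tendsto_id)

lemma clusterWeight_pos {m : ℕ → ℕ} (hm : ∀ i, 1 ≤ m i) {w : (i : ℕ) → Fin (m i) → ℝ}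
    (hw : ∀ i j, 0 < w i j) (i : ℕ) : 0 < clusterWeight w i :=
  Finset.sum_pos (fun j _ => hw i j) ⟨⟨0, hm i⟩, Finset.mem_univ _⟩

section Clusters

variable {Ω : Type*} [MeasurableSpace Ω] {P : Measure Ω}
  {E : Type*} [MeasurableSpace E] {μ : Measure E} {m : ℕ → ℕ}
  {X : (i : ℕ) → Fin (m i) → Ω → E} {w : (i : ℕ) → Fin (m i) → ℝ}

section Moments

variable {F : Type*} [NormedAddCommGroup F] [NormedSpace ℝ F] [MeasurableSpace F] [BorelSpace F]
  [SecondCountableTopology F]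

/-- Jensen's inequality inside the cluster leaves a weighted sum of marginal moments, so the bound
holds whatever the dependence within the cluster. -/
lemma integrable_norm_clusterSum_rpow (hm : ∀ i, 1 ≤ m i) (hw : ∀ i j, 0 < w i j)
    (hX : ∀ i j, MeasurePreserving (X i j) P μ) {g : E → F} (hg : Measurable g) {p : ℝ}
    (hp : 1 ≤ p) (hint : Integrable (fun x => ‖g x‖ ^ p) μ) (i : ℕ) :
    Integrable (fun ω => ‖∑ j, w i j • g (X i j ω)‖ ^ p) P ∧
      ∫ ω, ‖∑ j, w i j • g (X i j ω)‖ ^ p ∂P ≤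
        clusterWeight w i ^ p * ∫ x, ‖g x‖ ^ p ∂μ := by
  have hW := clusterWeight_pos hm hw i
  have hXi : ∀ j, Integrable (fun ω => ‖g (X i j ω)‖ ^ p) P := fun j =>
    (hX i j).integrable_comp_of_integrable hint
  have hle : ∀ ω, ‖∑ j, w i j • g (X i j ω)‖ ^ p ≤
      clusterWeight w i ^ (p - 1) * ∑ j, w i j * ‖g (X i j ω)‖ ^ p := by
    intro ω
    refine le_trans ?_ (sum_mul_rpow_le Finset.univ (w i) (fun j => ‖g (X i j ω)‖)
      (fun j _ => (hw i j).le) (fun j _ => norm_nonneg _) hW hp)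
    refine Real.rpow_le_rpow (norm_nonneg _) ((norm_sum_le _ _).trans_eq ?_) (by linarith)
    exact Finset.sum_congr rfl fun j _ => by
      rw [norm_smul, Real.norm_eq_abs, abs_of_pos (hw i j)]
  have hI : Integrable (fun ω => clusterWeight w i ^ (p - 1) *
      ∑ j, w i j * ‖g (X i j ω)‖ ^ p) P :=
    (integrable_finsetSum _ fun j _ => (hXi j).const_mul _).const_mul _
  have hmeas : Measurable fun ω => ∑ j, w i j • g (X i j ω) :=
    Finset.measurable_fun_sum _ fun j _ => (hg.comp (hX i j).measurable).const_smul _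
  have hI' : Integrable (fun ω => ‖∑ j, w i j • g (X i j ω)‖ ^ p) P := by
    refine hI.mono' (hmeas.norm.pow_const p).aestronglyMeasurable (ae_of_all _ fun ω => ?_)
    rw [Real.norm_of_nonneg (by positivity)]
    exact hle ω
  refine ⟨hI', (integral_mono hI' hI hle).trans_eq ?_⟩
  rw [integral_const_mul, integral_finsetSum _ fun j _ => (hXi j).const_mul _]
  have : ∀ j, ∫ ω, w i j * ‖g (X i j ω)‖ ^ p ∂P = w i j * ∫ x, ‖g x‖ ^ p ∂μ := fun j => by
    rw [integral_const_mul, ← (hX i j).map_eq, integral_map (hX i j).aemeasurable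
      (hg.norm.pow_const p).aestronglyMeasurable]
  simp only [this]
  rw [← Finset.sum_mul, ← mul_assoc]
  change clusterWeight w i ^ (p - 1) * clusterWeight w i * _ = _
  rw [← Real.rpow_add_one hW.ne', sub_add_cancel]

end Moments

/-- Strong law of large numbers for weighted averages over clusters. -/
theorem ae_tendsto_weighted_average [IsProbabilityMeasure P] (hm : ∀ i, 1 ≤ m i)
    (hw : ∀ i j, 0 < w i j)
    (hX : ∀ i j, MeasurePreserving (X i j) P μ) (hXindep : iIndepFun (fun i ω j => X i j ω) P)
    {ℓ : ℝ} (hℓ : 0 < ℓ) (hN : Tendsto (fun n : ℕ => (totalSize m n : ℝ) / n) atTop (𝓝 ℓ))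
    (hw_mean : Tendsto (fun n : ℕ => (∑ i ∈ Finset.range n, ∑ j, w i j) /
      (totalSize m n : ℝ)) atTop (𝓝 1))
    (hw_kol : Summable (fun i : ℕ => clusterWeight w i ^ 2 / ((i : ℝ) + 1) ^ 2))
    {f : E → ℝ} (hf : Measurable f) (hf2 : MemLp f 2 μ) :
    ∀ᵐ ω ∂P, Tendsto (fun n : ℕ => (∑ i ∈ Finset.range n, ∑ j, w i j * f (X i j ω)) /
      (totalSize m n : ℝ)) atTop (𝓝 (∫ x, f x ∂μ)) := by
  have hμ : IsProbabilityMeasure μ := (hX 0 ⟨0, hm 0⟩).map_eq ▸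
    Measure.isProbabilityMeasure_map (hX 0 ⟨0, hm 0⟩).aemeasurable
  set c := ∫ x, f x ∂μ
  let Z : ℕ → Ω → ℝ := fun i ω => ∑ j, w i j * (f (X i j ω) - c)
  have hg : MemLp (fun x => f x - c) 2 μ := hf2.sub (memLp_const c)
  have hgm : Measurable fun x => f x - c := hf.sub_const c
  have hgX : ∀ i j, MemLp (fun ω => f (X i j ω) - c) 2 P := fun i j =>
    hg.comp_measurePreserving (hX i j)
  have hZm : ∀ i, Measurable (Z i) := fun i =>
    Finset.measurable_fun_sum _ fun j _ => (hgm.comp (hX i j).measurable).const_mul _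
  have hZindep : iIndepFun Z P :=
    hXindep.comp (fun i y => ∑ j, w i j * (f (y j) - c)) fun i =>
      Finset.measurable_fun_sum _ fun j _ => (hgm.comp (measurable_pi_apply j)).const_mul _
  have hZ2 : ∀ i, MemLp (Z i) 2 P := fun i =>
    memLp_finsetSum _ fun j _ => (hgX i j).const_mul _
  have hZ0 : ∀ i, ∫ ω, Z i ω ∂P = 0 := by
    intro i
    have h0 : ∀ j, ∫ ω, (f (X i j ω) - c) ∂P = 0 := fun j => by
      have h1 : ∫ ω, (f (X i j ω) - c) ∂P = ∫ x, (f x - c) ∂μ := by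
        rw [← (hX i j).map_eq, integral_map (hX i j).aemeasurable hgm.aestronglyMeasurable]
      rw [h1, integral_sub (hf2.integrable (by norm_num)) (integrable_const _)]
      simp [c]
    simp only [Z]
    rw [integral_finsetSum _ fun j _ => ((hgX i j).integrable (by norm_num)).const_mul _]
    simp [integral_const_mul, h0]
  have hZbound : ∀ i, ∫ ω, Z i ω ^ 2 ∂P ≤
      clusterWeight w i ^ 2 * ∫ x, (f x - c) ^ 2 ∂μ := by
    intro i
    have h := (integrable_norm_clusterSum_rpow hm hw hX hgm (p := 2) (by norm_num)
      (by simpa [Real.rpow_two] using hg.integrable_sq) i).2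
    simpa [Real.rpow_two, Z] using h
  have hsum : Summable fun i : ℕ => (∫ ω, Z i ω ^ 2 ∂P) / ((i : ℝ) + 1) ^ 2 := by
    refine Summable.of_nonneg_of_le
      (fun i => div_nonneg (integral_nonneg fun ω => sq_nonneg _) (sq_nonneg _)) (fun i => ?_)
      (hw_kol.mul_right (∫ x, (f x - c) ^ 2 ∂μ))
    rw [div_mul_eq_mul_div]
    exact div_le_div_of_nonneg_right (hZbound i) (sq_nonneg _)
  filter_upwards [ae_tendsto_inv_mul_sum_of_summable_variance hZm hZindep hZ2 hZ0 hsum] with ω hω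
  -- Averages per cluster become averages per observation since `N_n / n` has a nonzero limit; the
  -- centering is restored because the mean weight tends to one.
  have h1 := (hω.div hN hℓ.ne').add (hw_mean.const_mul c)
  rw [zero_div, zero_add, mul_one] at h1
  refine h1.congr' ?_
  filter_upwards [eventually_gt_atTop 0] with n hn
  have hn' : (n : ℝ) ≠ 0 := by positivity
  have hN' : (totalSize m n : ℝ) ≠ 0 := by
    have := le_totalSize hm n
    have : 0 < totalSize m n := by omega
    positivity
  have h2 : ∑ i ∈ Finset.range n, ∑ j, w i j * f (X i j ω) =
      ∑ i ∈ Finset.range n, Z i ω + c * ∑ i ∈ Finset.range n, ∑ j, w i j := by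
    rw [Finset.mul_sum, ← Finset.sum_add_distrib]
    refine Finset.sum_congr rfl fun i _ => ?_
    simp only [Z]
    rw [Finset.mul_sum, ← Finset.sum_add_distrib]
    exact Finset.sum_congr rfl fun j _ => by ring
  rw [h2]
  simp only [Pi.div_apply]
  field_simp

end Clusters

/-! ### The central limit theorem for the estimating function at the true parameter -/

section CLT

/-- The contribution of cluster `i` to the estimating function. -/
def clusterScore {d : ℕ} {Ω : Type*} {m : ℕ → ℕ} (ρ : EuclideanSpace ℝ (Fin d) → ℝ)
    (θ : EuclideanSpace ℝ (Fin d)) (w : (i : ℕ) → Fin (m i) → ℝ)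
    (X : (i : ℕ) → Fin (m i) → Ω → EuclideanSpace ℝ (Fin d)) (i : ℕ) (ω : Ω) :
    EuclideanSpace ℝ (Fin d) :=
  ∑ j, w i j • score ρ (X i j ω) θ

lemma weightedScore_eq_sum {d : ℕ} {Ω : Type*} {m : ℕ → ℕ} {ρ : EuclideanSpace ℝ (Fin d) → ℝ}
    {θ : EuclideanSpace ℝ (Fin d)} {w : (i : ℕ) → Fin (m i) → ℝ}
    {X : (i : ℕ) → Fin (m i) → Ω → EuclideanSpace ℝ (Fin d)} (n : ℕ) (ω : Ω) :
    weightedScore ρ w X n ω θ = ∑ i ∈ Finset.range n, clusterScore ρ θ w X i ω := rfl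

variable {d : ℕ} {Ω : Type*} [MeasurableSpace Ω] {P : Measure Ω}
  {μ : Measure (EuclideanSpace ℝ (Fin d))} {m : ℕ → ℕ}
  {X : (i : ℕ) → Fin (m i) → Ω → EuclideanSpace ℝ (Fin d)} {w : (i : ℕ) → Fin (m i) → ℝ}
  {ρ : EuclideanSpace ℝ (Fin d) → ℝ} {θ : EuclideanSpace ℝ (Fin d)}

/-- The second moment matrix of a random vector. -/
def secondMoment (P : Measure Ω) (Y : Ω → EuclideanSpace ℝ (Fin d)) :
    Matrix (Fin d) (Fin d) ℝ :=
  Matrix.of fun k l => ∫ ω, Y ω k * Y ω l ∂P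

lemma memLp_coord {Y : Ω → EuclideanSpace ℝ (Fin d)} (hY : MemLp Y 2 P) (k : Fin d) :
    MemLp (fun ω => Y ω k) 2 P :=
  (EuclideanSpace.proj (𝕜 := ℝ) k).comp_memLp' hY

lemma integrable_coord_mul {Y Z : Ω → EuclideanSpace ℝ (Fin d)} (hY : MemLp Y 2 P)
    (hZ : MemLp Z 2 P) (k l : Fin d) : Integrable (fun ω => Y ω k * Z ω l) P :=
  (memLp_coord hY k).integrable_mul (memLp_coord hZ l)

/-- Identifies the variance of a one-dimensional projection of a centered vector, as needed to
reduce to the scalar central limit theorem. -/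
lemma integral_inner_sq {Y : Ω → EuclideanSpace ℝ (Fin d)} (hY : MemLp Y 2 P)
    (t : EuclideanSpace ℝ (Fin d)) :
    ∫ ω, inner ℝ (Y ω) t ^ 2 ∂P = t.ofLp ⬝ᵥ (secondMoment P Y).mulVec t.ofLp := by
  have h : ∀ ω, inner ℝ (Y ω) t ^ 2 = ∑ k, ∑ l, t k * t l * (Y ω k * Y ω l) := by
    intro ω
    rw [PiLp.inner_apply, sq, Finset.sum_mul_sum]
    refine Finset.sum_congr rfl fun k _ => Finset.sum_congr rfl fun l _ => ?_
    simp only [RCLike.inner_apply, conj_trivial]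
    ring
  simp only [h]
  rw [integral_finsetSum _ fun k _ => integrable_finsetSum _ fun l _ =>
    (integrable_coord_mul hY hY k l).const_mul _]
  refine Finset.sum_congr rfl fun k _ => ?_
  rw [integral_finsetSum _ fun l _ => (integrable_coord_mul hY hY k l).const_mul _,
    Matrix.mulVec, dotProduct, Finset.mul_sum]
  refine Finset.sum_congr rfl fun l _ => ?_
  rw [integral_const_mul, secondMoment, Matrix.of_apply]
  ring

/-- Diagonal pairs depend only on the common marginal law, and off-diagonal pairs are the summands
of `crossSum`. -/
lemma secondMoment_clusterScore (hX : ∀ i j, MeasurePreserving (X i j) P μ)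
    (hsm : Measurable fun x => score ρ x θ) (hsc : MemLp (fun x => score ρ x θ) 2 μ) (i : ℕ) :
    secondMoment P (clusterScore ρ θ w X i) =
      (∑ j, w i j ^ 2) • scoreSecondMoment ρ μ θ +
      ∑ j, ∑ j' ∈ Finset.univ.erase j,
        (w i j * w i j') • scoreCrossMoment P ρ θ (X i j) (X i j') := by
  have hsX : ∀ j, MemLp (fun ω => score ρ (X i j ω) θ) 2 P := fun j =>
    hsc.comp_measurePreserving (hX i j)
  have hdiag : ∀ j, scoreCrossMoment P ρ θ (X i j) (X i j) = scoreSecondMoment ρ μ θ := by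
    intro j
    ext k l
    simp only [scoreCrossMoment, scoreSecondMoment, Matrix.of_apply]
    have hc : ∀ k, Measurable fun x => score ρ x θ k := fun k =>
      (EuclideanSpace.proj (𝕜 := ℝ) k).continuous.measurable.comp hsm
    rw [← (hX i j).map_eq, integral_map (hX i j).aemeasurable
      (Measurable.aestronglyMeasurable (by exact (hc k).mul (hc l)))]
  have hall : secondMoment P (clusterScore ρ θ w X i) =
      ∑ j, ∑ j', (w i j * w i j') • scoreCrossMoment P ρ θ (X i j) (X i j') := by
    ext k l
    have h : ∀ ω, clusterScore ρ θ w X i ω k * clusterScore ρ θ w X i ω l =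
        ∑ j, ∑ j', w i j * w i j' * (score ρ (X i j ω) θ k * score ρ (X i j' ω) θ l) := by
      intro ω
      simp only [clusterScore, WithLp.ofLp_sum, WithLp.ofLp_smul, Finset.sum_apply, Pi.smul_apply,
        smul_eq_mul]
      rw [Finset.sum_mul_sum]
      exact Finset.sum_congr rfl fun j _ => Finset.sum_congr rfl fun j' _ => by ring
    simp only [secondMoment, Matrix.of_apply, h]
    rw [integral_finsetSum _ fun j _ => integrable_finsetSum _ fun j' _ =>
      (integrable_coord_mul (hsX j) (hsX j') k l).const_mul _]
    simp only [Matrix.sum_apply, Matrix.smul_apply, smul_eq_mul, scoreCrossMoment,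
      Matrix.of_apply]
    refine Finset.sum_congr rfl fun j _ => ?_
    rw [integral_finsetSum _ fun j' _ =>
      (integrable_coord_mul (hsX j) (hsX j') k l).const_mul _]
    exact Finset.sum_congr rfl fun j' _ => integral_const_mul _ _
  rw [hall, Finset.sum_smul, ← Finset.sum_add_distrib]
  refine Finset.sum_congr rfl fun j _ => ?_
  rw [← Finset.add_sum_erase _ _ (Finset.mem_univ j), hdiag, sq]

variable {cw : ℝ} {Cw : Matrix (Fin d) (Fin d) ℝ}

lemma tendsto_sum_secondMoment (hX : ∀ i j, MeasurePreserving (X i j) P μ)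
    (hsm : Measurable fun x => score ρ x θ) (hsc : MemLp (fun x => score ρ x θ) 2 μ)
    (hcw : Tendsto (fun n : ℕ => (∑ i ∈ Finset.range n, ∑ j, w i j ^ 2) /
      (totalSize m n : ℝ)) atTop (𝓝 cw))
    (hCw : Tendsto (fun n : ℕ => (totalSize m n : ℝ)⁻¹ • crossSum P ρ θ w X n) atTop (𝓝 Cw)) :
    Tendsto (fun n : ℕ => (totalSize m n : ℝ)⁻¹ •
      ∑ i ∈ Finset.range n, secondMoment P (clusterScore ρ θ w X i)) atTop
      (𝓝 (cw • scoreSecondMoment ρ μ θ + Cw)) := by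
  refine ((hcw.smul_const (scoreSecondMoment ρ μ θ)).add hCw).congr fun n => ?_
  simp only [secondMoment_clusterScore hX hsm hsc, Finset.sum_add_distrib, ← Finset.sum_smul]
  rw [smul_add, smul_smul, div_eq_inv_mul, crossSum]

lemma posSemidef_secondMoment {Y : Ω → EuclideanSpace ℝ (Fin d)} (hY : MemLp Y 2 P) :
    (secondMoment P Y).PosSemidef := by
  refine .of_dotProduct_mulVec_nonneg ?_ fun x => ?_
  · ext k l
    simp [secondMoment, mul_comm]
  · have h := integral_inner_sq hY (WithLp.toLp 2 x)
    rw [star_trivial, ← h]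
    exact integral_nonneg fun ω => sq_nonneg _

lemma posSemidef_of_tendsto {M : ℕ → Matrix (Fin d) (Fin d) ℝ} {A : Matrix (Fin d) (Fin d) ℝ}
    (hM : ∀ n, (M n).PosSemidef) (h : Tendsto M atTop (𝓝 A)) : A.PosSemidef := by
  refine .of_dotProduct_mulVec_nonneg ?_ fun x => ?_
  · have h1 : Tendsto (fun n => (M n).conjTranspose) atTop (𝓝 A.conjTranspose) :=
      ((continuous_id.matrix_conjTranspose).tendsto A).comp h
    exact tendsto_nhds_unique h1 (by simpa only [fun n => (hM n).isHermitian.eq] using h)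
  · have hc : Continuous fun B : Matrix (Fin d) (Fin d) ℝ => star x ⬝ᵥ B.mulVec x := by fun_prop
    exact ge_of_tendsto' ((hc.tendsto A).comp h) fun n => (hM n).dotProduct_mulVec_nonneg x

lemma memLp_clusterScore (hX : ∀ i j, MeasurePreserving (X i j) P μ)
    (hsc : MemLp (fun x => score ρ x θ) 2 μ) (i : ℕ) :
    MemLp (clusterScore ρ θ w X i) 2 P :=
  memLp_finsetSum _ fun j _ => (hsc.comp_measurePreserving (hX i j)).const_smul (w i j)

/-- `Cw` alone need not be positive semidefinite; the whole sum is, as a limit of averages of second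
moment matrices. -/
lemma posSemidef_limit (hX : ∀ i j, MeasurePreserving (X i j) P μ)
    (hsm : Measurable fun x => score ρ x θ) (hsc : MemLp (fun x => score ρ x θ) 2 μ)
    (hcw : Tendsto (fun n : ℕ => (∑ i ∈ Finset.range n, ∑ j, w i j ^ 2) /
      (totalSize m n : ℝ)) atTop (𝓝 cw))
    (hCw : Tendsto (fun n : ℕ => (totalSize m n : ℝ)⁻¹ • crossSum P ρ θ w X n) atTop (𝓝 Cw)) :
    (cw • scoreSecondMoment ρ μ θ + Cw).PosSemidef :=
  posSemidef_of_tendsto (fun n => (Matrix.posSemidef_sum _ fun i _ =>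
    posSemidef_secondMoment (memLp_clusterScore hX hsc i)).smul (by positivity))
    (tendsto_sum_secondMoment hX hsm hsc hcw hCw)

/-- The characteristic functions of the normalized estimating function at the true parameter
converge to those of a Gaussian law. -/
theorem tendsto_charFun_weightedScore [IsProbabilityMeasure P] (hm : ∀ i, 1 ≤ m i)
    (hw : ∀ i j, 0 < w i j) (hX : ∀ i j, MeasurePreserving (X i j) P μ)
    (hXindep : iIndepFun (fun i ω j => X i j ω) P)
    (hsm : Measurable fun x => score ρ x θ) (hsc : MemLp (fun x => score ρ x θ) 2 μ)
    (hmean : ∫ x, score ρ x θ ∂μ = 0)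
    (hcw : Tendsto (fun n : ℕ => (∑ i ∈ Finset.range n, ∑ j, w i j ^ 2) /
      (totalSize m n : ℝ)) atTop (𝓝 cw))
    (hCw : Tendsto (fun n : ℕ => (totalSize m n : ℝ)⁻¹ • crossSum P ρ θ w X n) atTop (𝓝 Cw))
    {p : ℝ} (hp : 2 < p) (hp3 : p ≤ 3) (hint : Integrable (fun x => ‖score ρ x θ‖ ^ p) μ)
    {B : ℝ} (hB : ∀ᶠ n in atTop,
      ∑ i ∈ Finset.range n, clusterWeight w i ^ p ≤ B * (totalSize m n : ℝ))
    (t : EuclideanSpace ℝ (Fin d)) :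
    Tendsto (fun n => charFun (P.map fun ω =>
      (√(totalSize m n : ℝ))⁻¹ • weightedScore ρ w X n ω θ) t) atTop
      (𝓝 (Complex.exp
        (-(t.ofLp ⬝ᵥ (cw • scoreSecondMoment ρ μ θ + Cw).mulVec t.ofLp / 2) : ℝ))) := by
  have hμ : IsProbabilityMeasure μ := (hX 0 ⟨0, hm 0⟩).map_eq ▸
    Measure.isProbabilityMeasure_map (hX 0 ⟨0, hm 0⟩).aemeasurable
  set Y := clusterScore ρ θ w X with hYdef
  have hYm : ∀ i, Measurable (Y i) := fun i =>
    Finset.measurable_fun_sum _ fun j _ => (hsm.comp (hX i j).measurable).const_smul (w i j)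
  -- The Cramér–Wold device: the characteristic function at `t` is that of the projection onto `t`,
  -- a sum of independent scalars.
  let Z : ℕ → Ω → ℝ := fun i ω => inner ℝ (Y i ω) t
  have hin : Measurable fun y : EuclideanSpace ℝ (Fin d) => inner ℝ y t := by fun_prop
  have hZm : ∀ i, Measurable (Z i) := fun i => hin.comp (hYm i)
  have hZindep : iIndepFun Z P :=
    hXindep.comp (fun i y => inner ℝ (∑ j, w i j • score ρ (y j) θ) t) fun i =>
      hin.comp (Finset.measurable_fun_sum _ fun j _ =>
        (hsm.comp (measurable_pi_apply j)).const_smul (w i j))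
  have hYint : ∀ i, Integrable (Y i) P := fun i =>
    (memLp_clusterScore hX hsc i).integrable (by norm_num)
  have hY0 : ∀ i, ∫ ω, Y i ω ∂P = 0 := by
    intro i
    have h0 : ∀ j, ∫ ω, score ρ (X i j ω) θ ∂P = 0 := fun j => by
      rw [← hmean, ← (hX i j).map_eq, integral_map (hX i j).aemeasurable hsm.aestronglyMeasurable]
    simp only [hYdef, clusterScore]
    have hI : ∀ j, Integrable (fun ω => w i j • score ρ (X i j ω) θ) P := fun j =>
      ((hsc.comp_measurePreserving (hX i j)).integrable (by norm_num)).smul (w i j)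
    rw [integral_finsetSum _ fun j _ => hI j]
    simp [integral_smul, h0]
  have hZ0 : ∀ i, ∫ ω, Z i ω ∂P = 0 := by
    intro i
    have h : ∀ ω, Z i ω = inner ℝ t (Y i ω) := fun ω => real_inner_comm _ _
    simp only [h]
    rw [integral_inner (hYint i), hY0, inner_zero_right]
  have hle : ∀ i ω, |Z i ω| ^ p ≤ ‖t‖ ^ p * ‖Y i ω‖ ^ p := fun i ω => by
    rw [← Real.mul_rpow (norm_nonneg _) (norm_nonneg _), mul_comm]
    exact Real.rpow_le_rpow (abs_nonneg _) (abs_real_inner_le_norm _ _) (by linarith)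
  have hYp := integrable_norm_clusterSum_rpow hm hw hX hsm (by linarith : 1 ≤ p) hint
  have hZp : ∀ i, Integrable (fun ω => |Z i ω| ^ p) P := fun i => by
    refine ((hYp i).1.const_mul (‖t‖ ^ p)).mono'
      ((hZm i).norm.pow_const p).aestronglyMeasurable (ae_of_all _ fun ω => ?_)
    rw [Real.norm_of_nonneg (by positivity)]
    exact hle i ω
  have hZB : ∀ i, ∫ ω, |Z i ω| ^ p ∂P ≤
      ‖t‖ ^ p * (∫ x, ‖score ρ x θ‖ ^ p ∂μ) * clusterWeight w i ^ p := by
    intro i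
    refine (integral_mono (hZp i) ((hYp i).1.const_mul (‖t‖ ^ p)) (hle i)).trans ?_
    rw [integral_const_mul, mul_assoc, mul_comm (∫ x, ‖score ρ x θ‖ ^ p ∂μ)]
    exact mul_le_mul_of_nonneg_left (hYp i).2 (by positivity)
  have hI0 : 0 ≤ ∫ x, ‖score ρ x θ‖ ^ p ∂μ := integral_nonneg fun x => by positivity
  have hvar : Tendsto (fun n => (∑ i ∈ Finset.range n, ∫ ω, Z i ω ^ 2 ∂P) /
      (totalSize m n : ℝ)) atTop
      (𝓝 (t.ofLp ⬝ᵥ (cw • scoreSecondMoment ρ μ θ + Cw).mulVec t.ofLp)) := by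
    have hc : Continuous fun A : Matrix (Fin d) (Fin d) ℝ => t.ofLp ⬝ᵥ A.mulVec t.ofLp := by
      fun_prop
    refine ((hc.tendsto _).comp (tendsto_sum_secondMoment hX hsm hsc hcw hCw)).congr fun n => ?_
    have h : ∀ i, ∫ ω, Z i ω ^ 2 ∂P = t.ofLp ⬝ᵥ (secondMoment P (Y i)).mulVec t.ofLp := fun i =>
      integral_inner_sq (memLp_clusterScore hX hsc i) t
    simp only [h, Function.comp_apply, Matrix.smul_mulVec, dotProduct_smul, Matrix.sum_mulVec,
      dotProduct_sum, smul_eq_mul]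
    rw [div_eq_inv_mul]
  have hclt := tendsto_charFun_of_lyapunov hZm hZindep hZ0 hp hp3 hZp (tendsto_totalSize hm) hvar
    (B := ‖t‖ ^ p * (∫ x, ‖score ρ x θ‖ ^ p ∂μ) * B) (by
      filter_upwards [hB] with n hn
      refine (Finset.sum_le_sum fun i _ => hZB i).trans ?_
      rw [← Finset.mul_sum, mul_assoc _ B]
      exact mul_le_mul_of_nonneg_left hn (by positivity))
  refine hclt.congr fun n => ?_
  have hSm : Measurable fun ω => (√(totalSize m n : ℝ))⁻¹ • weightedScore ρ w X n ω θ :=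
    (Finset.measurable_fun_sum (Finset.range n) fun i _ => hYm i).const_smul
      (√(totalSize m n : ℝ))⁻¹
  rw [charFun_apply_real, charFun_apply, integral_map
    (Finset.measurable_fun_sum _ fun i _ => hZm i).aemeasurable (by fun_prop),
    integral_map hSm.aemeasurable (by fun_prop)]
  refine integral_congr_ae (ae_of_all _ fun ω => ?_)
  simp only [weightedScore_eq_sum, real_inner_smul_left, sum_inner, Z]
  push_cast
  rfl

end CLT

/-! ### Consistency -/

section Consistency

variable {d : ℕ} {ρ : EuclideanSpace ℝ (Fin d) → ℝ}
  {Θ : Set (EuclideanSpace ℝ (Fin d))} {θ : EuclideanSpace ℝ (Fin d)} {K lam : ℝ}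

lemma norm_weightedScore_sub_le {Ω : Type*} {m : ℕ → ℕ} {w : (i : ℕ) → Fin (m i) → ℝ}
    (hw : ∀ i j, 0 < w i j) {X : (i : ℕ) → Fin (m i) → Ω → EuclideanSpace ℝ (Fin d)}
    {a b : EuclideanSpace ℝ (Fin d)} {g : EuclideanSpace ℝ (Fin d) → ℝ}
    (hg : ∀ x, ‖score ρ x a - score ρ x b‖ ≤ g x * ‖a - b‖) (n : ℕ) (ω : Ω) :
    ‖weightedScore ρ w X n ω a - weightedScore ρ w X n ω b‖ ≤
      (∑ i ∈ Finset.range n, ∑ j, w i j * g (X i j ω)) * ‖a - b‖ := by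
  simp only [weightedScore, ← Finset.sum_sub_distrib, ← smul_sub, Finset.sum_mul]
  refine (norm_sum_le _ _).trans (Finset.sum_le_sum fun i _ => (norm_sum_le _ _).trans
    (Finset.sum_le_sum fun j _ => ?_))
  rw [norm_smul, Real.norm_eq_abs, abs_of_pos (hw i j), mul_assoc]
  exact mul_le_mul_of_nonneg_left (hg _) (hw i j).le

/-- Zeros of functions that are equi-Lipschitz and converge pointwise on a dense subset converge to
the unique zero of the limit. -/
lemma tendsto_zero_of_lipschitz {E F : Type*} [NormedAddCommGroup E] [NormedAddCommGroup F]
    {S D : Set E} (hS : IsCompact (closure S)) (hDS : D ⊆ S) (hD : S ⊆ closure D) {x₀ : E}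
    {f : ℕ → E → F} {f₀ : E → F} {L : ℕ → ℝ} {Λ Λ₀ : ℝ}
    (hf : ∀ n, ∀ a ∈ S, ∀ b ∈ S, ‖f n a - f n b‖ ≤ L n * ‖a - b‖)
    (hL : Tendsto L atTop (𝓝 Λ))
    (hf₀ : ∀ a ∈ closure S, ∀ b ∈ closure S, ‖f₀ a - f₀ b‖ ≤ Λ₀ * ‖a - b‖)
    (hlim : ∀ a ∈ D, Tendsto (fun n => f n a) atTop (𝓝 (f₀ a)))
    (huniq : ∀ a ∈ closure S, f₀ a = 0 → a = x₀)
    {z : ℕ → E} (hz : ∀ᶠ n in atTop, z n ∈ S ∧ f n (z n) = 0) :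
    Tendsto z atTop (𝓝 x₀) := by
  -- In a compact set it suffices to show that each cluster point `y` of the zeros is a zero of
  -- `f₀`.
  refine hS.tendsto_nhds_of_unique_mapClusterPt (hz.mono fun n hn => subset_closure hn.1)
    fun y hy hclus => huniq y hy ?_
  by_contra hne
  have hpos : 0 < ‖f₀ y‖ := norm_pos_iff.2 hne
  -- The choice of `ε` makes the total error, `2(|Λ| + 1)ε` from `b` to the zero `z n` and `|Λ₀|ε`
  -- from `y` to `b`, at most half of `‖f₀ y‖`.
  set C := |Λ| + 1 + |Λ₀|
  have hC : 0 < C := by positivity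
  set ε := ‖f₀ y‖ / (4 * C)
  have hε : 0 < ε := by positivity
  have hyD : y ∈ closure D := closure_minimal hD isClosed_closure hy
  obtain ⟨b, hbD, hb⟩ := Metric.mem_closure_iff.1 hyD ε hε
  have hbS := hDS hbD
  rw [dist_eq_norm] at hb
  have hfreq : ∃ᶠ n in atTop, z n ∈ Metric.ball y ε :=
    hclus.frequently (Metric.ball_mem_nhds y hε)
  have hbound : ‖f₀ b‖ ≤ (|Λ| + 1) * (2 * ε) := by
    by_contra! hlt
    have h1 : ∀ᶠ n in atTop, (|Λ| + 1) * (2 * ε) < ‖f n b‖ :=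
      (hlim b hbD).norm.eventually_const_lt hlt
    have h2 : ∀ᶠ n in atTop, L n < |Λ| + 1 :=
      hL.eventually_lt_const (by linarith [le_abs_self Λ])
    obtain ⟨n, hn, ⟨hzS, hz0⟩, h1n, h2n⟩ := (hfreq.and_eventually (hz.and (h1.and h2))).exists
    rw [Metric.mem_ball, dist_eq_norm] at hn
    have h3 : ‖b - z n‖ ≤ 2 * ε := by
      have := norm_sub_le_norm_sub_add_norm_sub b y (z n)
      rw [norm_sub_rev b y, norm_sub_rev y (z n)] at this
      linarith
    have h4 := hf n b hbS (z n) hzS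
    rw [hz0, sub_zero] at h4
    have h5 : L n * ‖b - z n‖ ≤ (|Λ| + 1) * (2 * ε) := by gcongr
    linarith
  have h6 := hf₀ y hy b (subset_closure hbS)
  have h7 : Λ₀ * ‖y - b‖ ≤ |Λ₀| * ε := by
    have := le_abs_self Λ₀
    gcongr
  have h8 := norm_le_norm_add_norm_sub' (f₀ y) (f₀ b)
  have h9 : 4 * C * ε = ‖f₀ y‖ := by simp only [ε]; field_simp
  have h10 : |Λ₀| * ε ≤ |Λ₀| * ε * 2 := by
    have : 0 ≤ |Λ₀| * ε := by positivity
    linarith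
  simp only [C] at h9
  linarith

variable {Ω : Type*} [MeasurableSpace Ω] {P : Measure Ω}
  {μ : Measure (EuclideanSpace ℝ (Fin d))} {m : ℕ → ℕ}
  {X : (i : ℕ) → Fin (m i) → Ω → EuclideanSpace ℝ (Fin d)} {w : (i : ℕ) → Fin (m i) → ℝ}

/-- Strong law of large numbers for the estimating function at a fixed parameter. -/
lemma ae_tendsto_weightedScore [IsProbabilityMeasure P] (hm : ∀ i, 1 ≤ m i)
    (hw : ∀ i j, 0 < w i j)
    (hX : ∀ i j, MeasurePreserving (X i j) P μ) (hXindep : iIndepFun (fun i ω j => X i j ω) P)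
    {ℓ : ℝ} (hℓ : 0 < ℓ) (hN : Tendsto (fun n : ℕ => (totalSize m n : ℝ) / n) atTop (𝓝 ℓ))
    (hw_mean : Tendsto (fun n : ℕ => (∑ i ∈ Finset.range n, ∑ j, w i j) /
      (totalSize m n : ℝ)) atTop (𝓝 1))
    (hw_kol : Summable (fun i : ℕ => clusterWeight w i ^ 2 / ((i : ℝ) + 1) ^ 2))
    {a : EuclideanSpace ℝ (Fin d)} (hsm : Measurable fun x => score ρ x a)
    (hsc : MemLp (fun x => score ρ x a) 2 μ) :
    ∀ᵐ ω ∂P, Tendsto (fun n : ℕ => (totalSize m n : ℝ)⁻¹ • weightedScore ρ w X n ω a) atTop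
      (𝓝 (∫ x, score ρ x a ∂μ)) := by
  have hμ : IsProbabilityMeasure μ := (hX 0 ⟨0, hm 0⟩).map_eq ▸
    Measure.isProbabilityMeasure_map (hX 0 ⟨0, hm 0⟩).aemeasurable
  have h : ∀ᵐ ω ∂P, ∀ k, Tendsto (fun n : ℕ =>
      (∑ i ∈ Finset.range n, ∑ j, w i j * score ρ (X i j ω) a k) / (totalSize m n : ℝ)) atTop
      (𝓝 (∫ x, score ρ x a k ∂μ)) := ae_all_iff.2 fun k =>
    ae_tendsto_weighted_average hm hw hX hXindep hℓ hN hw_mean hw_kol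
      (f := fun x => score ρ x a k)
      ((EuclideanSpace.proj (𝕜 := ℝ) k).continuous.measurable.comp hsm) (memLp_coord hsc k)
  filter_upwards [h] with ω hω
  have hcont : Continuous (WithLp.toLp 2 : (Fin d → ℝ) → EuclideanSpace ℝ (Fin d)) :=
    PiLp.continuous_toLp 2 _
  have hpi := (hcont.tendsto _).comp (tendsto_pi_nhds.2 hω)
  have hlim : WithLp.toLp 2 (fun k => ∫ x, score ρ x a k ∂μ) = ∫ x, score ρ x a ∂μ := by
    ext k
    exact ((EuclideanSpace.proj (𝕜 := ℝ) k).integral_comp_comm (hsc.integrable (by norm_num)))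
  rw [hlim] at hpi
  refine hpi.congr fun n => ?_
  ext k
  simp [weightedScore, div_eq_inv_mul]

/-- Strong consistency of weighted M-estimators. -/
theorem ae_tendsto_estimator [IsProbabilityMeasure P] (hΘ : Convex ℝ Θ)
    (hΘbdd : Bornology.IsBounded Θ) (hθ : θ ∈ Θ) (hm : ∀ i, 1 ≤ m i) (hw : ∀ i j, 0 < w i j)
    (hX : ∀ i j, MeasurePreserving (X i j) P μ) (hXindep : iIndepFun (fun i ω j => X i j ω) P)
    {ℓ : ℝ} (hℓ : 0 < ℓ) (hN : Tendsto (fun n : ℕ => (totalSize m n : ℝ) / n) atTop (𝓝 ℓ))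
    (hw_mean : Tendsto (fun n : ℕ => (∑ i ∈ Finset.range n, ∑ j, w i j) /
      (totalSize m n : ℝ)) atTop (𝓝 1))
    (hw_kol : Summable (fun i : ℕ => clusterWeight w i ^ 2 / ((i : ℝ) + 1) ^ 2))
    (hρ : Differentiable ℝ ρ) (hψ : ∀ x, Differentiable ℝ (score ρ x))
    (hzero : ∀ a ∈ closure Θ, ∫ x, score ρ x a ∂μ = 0 ↔ a = θ)
    (hlam : 0 < lam)
    (hHolder : ∀ x, ∀ a ∈ Θ, ∀ b ∈ Θ,
      ‖scoreDeriv ρ x a - scoreDeriv ρ x b‖ ≤ K * ‖a - b‖ ^ lam)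
    (hψsq : ∀ k l, Integrable (fun x => scoreJacobian ρ x θ k l ^ 2) μ)
    (hsc : MemLp (fun x => score ρ x θ) 2 μ)
    {θhat : ℕ → Ω → EuclideanSpace ℝ (Fin d)}
    (hθhat : ∀ᵐ ω ∂P, ∀ᶠ n in atTop, θhat n ω ∈ Θ ∧ weightedScore ρ w X n ω (θhat n ω) = 0) :
    ∀ᵐ ω ∂P, Tendsto (fun n => θhat n ω) atTop (𝓝 θ) := by
  have hμ : IsProbabilityMeasure μ := (hX 0 ⟨0, hm 0⟩).map_eq ▸
    Measure.isProbabilityMeasure_map (hX 0 ⟨0, hm 0⟩).aemeasurable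
  obtain ⟨D, hD⟩ : ∃ D, ∀ a ∈ Θ, ∀ b ∈ Θ, ‖a - b‖ ≤ D := by
    obtain ⟨D, hD⟩ := Metric.isBounded_iff.1 hΘbdd
    exact ⟨D, fun a ha b hb => dist_eq_norm a b ▸ hD ha hb⟩
  set g : EuclideanSpace ℝ (Fin d) → ℝ := fun x => ‖scoreDeriv ρ x θ‖ + |K| * D ^ lam
  have hg : MemLp g 2 μ := (memLp_norm_scoreDeriv hρ hψ hψsq).add (memLp_const _)
  have hlip : ∀ x, ∀ a ∈ closure Θ, ∀ b ∈ closure Θ,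
      ‖score ρ x a - score ρ x b‖ ≤ g x * ‖a - b‖ := fun x a ha b hb =>
    norm_score_sub_le hΘ hθ hψ hlam hHolder hD x ha hb
  have hsa : ∀ a ∈ closure Θ, MemLp (fun x => score ρ x a) 2 μ := fun a ha =>
    memLp_score hΘ hθ hρ hψ hlam hHolder hD hψsq hsc ha
  -- Countability lets a single null set serve for all these parameters; the Lipschitz bounds do the
  -- rest.
  obtain ⟨S, hSΘ, hScount, hSdense⟩ := 
    (TopologicalSpace.IsSeparable.of_separableSpace Θ).exists_countable_dense_subset
  have hslln : ∀ᵐ ω ∂P, ∀ a ∈ S, Tendsto (fun n : ℕ =>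
      (totalSize m n : ℝ)⁻¹ • weightedScore ρ w X n ω a) atTop (𝓝 (∫ x, score ρ x a ∂μ)) :=
    (ae_ball_iff hScount).2 fun a ha =>
      ae_tendsto_weightedScore hm hw hX hXindep hℓ hN hw_mean hw_kol
        (continuous_score_left hρ hψ a).measurable (hsa a (subset_closure (hSΘ ha)))
  have hgslln := ae_tendsto_weighted_average hm hw hX hXindep hℓ hN hw_mean hw_kol
    (f := g) ((measurable_scoreDeriv_left hρ hψ θ).norm.add_const _) hg
  filter_upwards [hslln, hgslln, hθhat] with ω h1 h2 h3
  refine tendsto_zero_of_lipschitz (S := Θ) (D := S) hΘbdd.isCompact_closure hSΘ hSdense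
    (f := fun n a => (totalSize m n : ℝ)⁻¹ • weightedScore ρ w X n ω a)
    (f₀ := fun a => ∫ x, score ρ x a ∂μ) (Λ₀ := ∫ x, g x ∂μ) (fun n a ha b hb => ?_) h2
    (fun a ha b hb => ?_) h1 (fun a ha h => (hzero a ha).1 h) ?_
  · rw [← smul_sub, norm_smul, norm_inv, Real.norm_natCast, div_mul_eq_mul_div, div_eq_inv_mul]
    exact mul_le_mul_of_nonneg_left (norm_weightedScore_sub_le hw
      (fun x => hlip x a (subset_closure ha) b (subset_closure hb)) n ω) (by positivity)
  · rw [← integral_sub ((hsa a ha).integrable (by norm_num)) ((hsa b hb).integrable (by norm_num)),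
      ← integral_mul_const]
    exact norm_integral_le_of_norm_le ((hg.integrable (by norm_num)).mul_const _)
      (ae_of_all _ fun x => hlip x a ha b hb)
  · filter_upwards [h3] with n hn
    exact ⟨hn.1, by simp only [hn.2, smul_zero]⟩

end Consistency

/-! ### Asymptotic normality -/

section Normality

lemma rpow_le_one_add_rpow {x p q : ℝ} (hx : 0 ≤ x) (hp : 0 ≤ p) (hpq : p ≤ q) :
    x ^ p ≤ 1 + x ^ q := by
  rcases le_total x 1 with h | h
  · have h1 := Real.rpow_le_one hx h hp
    have h2 : 0 ≤ x ^ q := by positivity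
    linarith
  · have := Real.rpow_le_rpow_of_exponent_le h hpq
    linarith

lemma isLittleO_of_norm_le_mul {E F : Type*} [NormedAddCommGroup E] [NormedAddCommGroup F]
    {f : ℕ → E} {g : ℕ → F} {c : ℕ → ℝ} (hc : Tendsto c atTop (𝓝 0))
    (h : ∀ᶠ n in atTop, ‖f n‖ ≤ c n * ‖g n‖) : f =o[atTop] g := by
  rw [Asymptotics.isLittleO_iff]
  intro ε hε
  filter_upwards [h, hc.eventually_le_const hε] with n hn hcn
  exact hn.trans (mul_le_mul_of_nonneg_right hcn (norm_nonneg _))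

variable {d : ℕ} {ρ : EuclideanSpace ℝ (Fin d) → ℝ}
  {Θ : Set (EuclideanSpace ℝ (Fin d))} {θ : EuclideanSpace ℝ (Fin d)} {K lam : ℝ}

/-- First order expansion of the estimating function. -/
lemma norm_weightedScore_expansion_le {Ω : Type*} {m : ℕ → ℕ} {w : (i : ℕ) → Fin (m i) → ℝ}
    (hw : ∀ i j, 0 < w i j) {X : (i : ℕ) → Fin (m i) → Ω → EuclideanSpace ℝ (Fin d)}
    (hΘ : Convex ℝ Θ) (hθ : θ ∈ Θ) (hψ : ∀ x, Differentiable ℝ (score ρ x)) (hlam : 0 < lam)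
    (hHolder : ∀ x, ∀ a ∈ Θ, ∀ b ∈ Θ,
      ‖scoreDeriv ρ x a - scoreDeriv ρ x b‖ ≤ K * ‖a - b‖ ^ lam)
    {a : EuclideanSpace ℝ (Fin d)} (ha : a ∈ Θ) (n : ℕ) (ω : Ω) :
    ‖weightedScore ρ w X n ω a - weightedScore ρ w X n ω θ -
        (∑ i ∈ Finset.range n, ∑ j, w i j • scoreDeriv ρ (X i j ω) θ) (a - θ)‖ ≤
      (∑ i ∈ Finset.range n, ∑ j, w i j) * (|K| * ‖a - θ‖ ^ lam * ‖a - θ‖) := by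
  simp only [weightedScore, sum_apply, smul_apply,
    ← Finset.sum_sub_distrib, ← smul_sub, Finset.sum_mul]
  refine (norm_sum_le _ _).trans (Finset.sum_le_sum fun i _ => (norm_sum_le _ _).trans
    (Finset.sum_le_sum fun j _ => ?_))
  rw [norm_smul, Real.norm_eq_abs, abs_of_pos (hw i j)]
  exact mul_le_mul_of_nonneg_left (norm_score_sub_sub_le hΘ hθ hψ hlam hHolder _ ha) (hw i j).le

/-- Linearization of the estimating equation along a consistent sequence of zeros. -/
lemma isLittleO_linearization {Ω : Type*} {m : ℕ → ℕ} {w : (i : ℕ) → Fin (m i) → ℝ}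
    (hw : ∀ i j, 0 < w i j) {X : (i : ℕ) → Fin (m i) → Ω → EuclideanSpace ℝ (Fin d)}
    (hΘ : Convex ℝ Θ) (hθ : θ ∈ Θ)
    (hw_mean : Tendsto (fun n : ℕ => (∑ i ∈ Finset.range n, ∑ j, w i j) /
      (totalSize m n : ℝ)) atTop (𝓝 1))
    (hψ : ∀ x, Differentiable ℝ (score ρ x)) (hlam : 0 < lam)
    (hHolder : ∀ x, ∀ a ∈ Θ, ∀ b ∈ Θ,
      ‖scoreDeriv ρ x a - scoreDeriv ρ x b‖ ≤ K * ‖a - b‖ ^ lam)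
    {ω : Ω} {A : EuclideanSpace ℝ (Fin d) →L[ℝ] EuclideanSpace ℝ (Fin d)}
    (hA : Tendsto (fun n : ℕ => (totalSize m n : ℝ)⁻¹ •
        ∑ i ∈ Finset.range n, ∑ j, w i j • scoreDeriv ρ (X i j ω) θ) atTop (𝓝 A))
    {z : ℕ → EuclideanSpace ℝ (Fin d)} (hz : Tendsto z atTop (𝓝 θ))
    (hz0 : ∀ᶠ n in atTop, z n ∈ Θ ∧ weightedScore ρ w X n ω (z n) = 0) :
    (fun n => A (z n - θ) + (totalSize m n : ℝ)⁻¹ • weightedScore ρ w X n ω θ)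
      =o[atTop] fun n => z n - θ := by
  set G : ℕ → EuclideanSpace ℝ (Fin d) →L[ℝ] EuclideanSpace ℝ (Fin d) := fun n =>
    (totalSize m n : ℝ)⁻¹ • ∑ i ∈ Finset.range n, ∑ j, w i j • scoreDeriv ρ (X i j ω) θ with hG
  have hz' : Tendsto (fun n => ‖z n - θ‖) atTop (𝓝 0) := by
    simpa using (hz.sub_const θ).norm
  -- The relative error has two sources: the Hölder remainder, small by consistency, and the
  -- distance of the averaged derivative `G n` from its limit `A`.
  have hc : Tendsto (fun n => (∑ i ∈ Finset.range n, ∑ j, w i j) / (totalSize m n : ℝ) *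
      (|K| * ‖z n - θ‖ ^ lam) + ‖A - G n‖) atTop (𝓝 0) := by
    have h1 : Tendsto (fun n => ‖z n - θ‖ ^ lam) atTop (𝓝 0) := by
      have := hz'.rpow_const (p := lam) (Or.inr hlam.le)
      rwa [Real.zero_rpow hlam.ne'] at this
    have h2 : Tendsto (fun n => ‖A - G n‖) atTop (𝓝 0) := by
      simpa using (hA.const_sub A).norm
    simpa using (hw_mean.mul (h1.const_mul |K|)).add h2
  refine isLittleO_of_norm_le_mul hc ?_
  filter_upwards [hz0] with n ⟨hn, hn0⟩
  have h1 := norm_weightedScore_expansion_le hw (X := X) hΘ hθ hψ hlam hHolder hn n ω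
  rw [hn0, zero_sub, ← neg_add', norm_neg] at h1
  have h2 : A (z n - θ) + (totalSize m n : ℝ)⁻¹ • weightedScore ρ w X n ω θ =
      (totalSize m n : ℝ)⁻¹ • (weightedScore ρ w X n ω θ +
        (∑ i ∈ Finset.range n, ∑ j, w i j • scoreDeriv ρ (X i j ω) θ) (z n - θ)) +
      (A - G n) (z n - θ) := by
    simp only [hG, sub_apply, smul_apply, smul_add]
    abel
  rw [h2, add_mul]
  refine (norm_add_le _ _).trans (add_le_add ?_ ((A - G n).le_opNorm _))
  rw [norm_smul, norm_inv, Real.norm_natCast, div_eq_inv_mul, mul_assoc, mul_assoc]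
  refine mul_le_mul_of_nonneg_left (h1.trans_eq ?_) (by positivity)
  ring

variable {Ω : Type*} [MeasurableSpace Ω] {P : Measure Ω}
  {μ : Measure (EuclideanSpace ℝ (Fin d))} {m : ℕ → ℕ}
  {X : (i : ℕ) → Fin (m i) → Ω → EuclideanSpace ℝ (Fin d)} {w : (i : ℕ) → Fin (m i) → ℝ}

lemma ae_tendsto_scoreDeriv_average [IsProbabilityMeasure P] (hm : ∀ i, 1 ≤ m i)
    (hw : ∀ i j, 0 < w i j)
    (hX : ∀ i j, MeasurePreserving (X i j) P μ) (hXindep : iIndepFun (fun i ω j => X i j ω) P)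
    {ℓ : ℝ} (hℓ : 0 < ℓ) (hN : Tendsto (fun n : ℕ => (totalSize m n : ℝ) / n) atTop (𝓝 ℓ))
    (hw_mean : Tendsto (fun n : ℕ => (∑ i ∈ Finset.range n, ∑ j, w i j) /
      (totalSize m n : ℝ)) atTop (𝓝 1))
    (hw_kol : Summable (fun i : ℕ => clusterWeight w i ^ 2 / ((i : ℝ) + 1) ^ 2))
    (hρ : Differentiable ℝ ρ) (hψ : ∀ x, Differentiable ℝ (score ρ x))
    (hψsq : ∀ k l, Integrable (fun x => scoreJacobian ρ x θ k l ^ 2) μ) :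
    ∀ᵐ ω ∂P, Tendsto (fun n : ℕ => (totalSize m n : ℝ)⁻¹ •
        ∑ i ∈ Finset.range n, ∑ j, w i j • scoreDeriv ρ (X i j ω) θ) atTop
      (𝓝 (Matrix.toEuclideanCLM (𝕜 := ℝ) (meanJacobian ρ μ θ))) := by
  have h : ∀ᵐ ω ∂P, ∀ k l, Tendsto (fun n : ℕ =>
      (∑ i ∈ Finset.range n, ∑ j, w i j * scoreJacobian ρ (X i j ω) θ k l) /
        (totalSize m n : ℝ)) atTop (𝓝 (meanJacobian ρ μ θ k l)) :=
    ae_all_iff.2 fun k => ae_all_iff.2 fun l =>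
      ae_tendsto_weighted_average hm hw hX hXindep hℓ hN hw_mean hw_kol
        (f := fun x => scoreJacobian ρ x θ k l) (measurable_scoreJacobian_left hρ hψ θ k l)
        ((memLp_two_iff_integrable_sq
          (measurable_scoreJacobian_left hρ hψ θ k l).aestronglyMeasurable).2 (hψsq k l))
  filter_upwards [h] with ω hω
  have hM : Tendsto (fun n : ℕ => (totalSize m n : ℝ)⁻¹ •
      ∑ i ∈ Finset.range n, ∑ j, w i j • scoreJacobian ρ (X i j ω) θ) atTop
      (𝓝 (meanJacobian ρ μ θ)) := by
    refine tendsto_pi_nhds.2 fun k => tendsto_pi_nhds.2 fun l => (hω k l).congr fun n => ?_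
    simp [Matrix.sum_apply, div_eq_inv_mul]
  have hcont : Continuous (Matrix.toEuclideanCLM (n := Fin d) (𝕜 := ℝ)) :=
    LinearMap.continuous_of_finiteDimensional
      (Matrix.toEuclideanCLM (n := Fin d) (𝕜 := ℝ)).toAlgEquiv.toLinearMap
  refine ((hcont.tendsto _).comp hM).congr fun n => ?_
  simp only [Function.comp_apply, map_smul, map_sum, scoreDeriv_eq_toEuclideanCLM]

/-- Symmetry of the mean Jacobian makes the sandwich a congruence, which preserves positive
semidefiniteness. -/
lemma posSemidef_asymptoticCov (hρ : Differentiable ℝ ρ) (hψ : ∀ x, Differentiable ℝ (score ρ x))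
    {cw : ℝ} {Cw : Matrix (Fin d) (Fin d) ℝ}
    (h : (cw • scoreSecondMoment ρ μ θ + Cw).PosSemidef) :
    (asymptoticCov ρ μ θ cw Cw).PosSemidef := by
  have h1 := h.mul_mul_conjTranspose_same (meanJacobian ρ μ θ)⁻¹
  rwa [Matrix.conjTranspose_eq_transpose_of_trivial, Matrix.transpose_nonsing_inv,
    meanJacobian_transpose hρ hψ] at h1

/-- Convergence in distribution of the linear approximation to the estimator. -/
lemma tendstoInDistribution_linear [IsProbabilityMeasure P]
    {V M : Matrix (Fin d) (Fin d) ℝ} (hV : V.transpose = V) (hM : (V * M * V).PosSemidef)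
    {S : ℕ → Ω → EuclideanSpace ℝ (Fin d)} (hS : ∀ n, AEMeasurable (S n) P)
    (h : ∀ t, Tendsto (fun n => charFun (P.map (S n)) t) atTop
      (𝓝 (Complex.exp (-(t.ofLp ⬝ᵥ M.mulVec t.ofLp / 2) : ℝ)))) :
    TendstoInDistribution (fun n ω => -Matrix.toEuclideanCLM (𝕜 := ℝ) V (S n ω)) atTop id
      (fun _ => P) (multivariateGaussian 0 (V * M * V)) where
  forall_aemeasurable n := by
    have := hS n
    fun_prop
  aemeasurable_limit := aemeasurable_id
  tendsto := by
    refine ProbabilityMeasure.tendsto_iff_tendsto_charFun.2 fun t => ?_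
    set T := Matrix.toEuclideanCLM (𝕜 := ℝ) V
    have hquad : (-T t).ofLp ⬝ᵥ M.mulVec (-T t).ofLp = t.ofLp ⬝ᵥ (V * M * V).mulVec t.ofLp := by
      simp only [T, WithLp.ofLp_neg, Matrix.ofLp_toEuclideanCLM, Matrix.mulVec_neg,
        neg_dotProduct_neg]
      rw [← Matrix.mulVec_mulVec, ← Matrix.mulVec_mulVec, Matrix.dotProduct_mulVec t.ofLp V,
        ← Matrix.mulVec_transpose, hV]
    -- `T` is self-adjoint, so the characteristic function of `-T (S n)` at `t` is that of `S n` at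
    -- `-T t`.
    have hsymm : ∀ x, inner ℝ (-T x) t = inner ℝ x (-T t) := by
      intro x
      rw [inner_neg_left, inner_neg_right, real_inner_comm, Matrix.inner_toEuclideanCLM,
        Matrix.inner_toEuclideanCLM, Matrix.dotProduct_mulVec, ← Matrix.mulVec_transpose, hV,
        dotProduct_comm]
    have hlim := h (-T t)
    rw [hquad] at hlim
    simp only [ProbabilityMeasure.coe_mk, Measure.map_id]
    rw [charFun_multivariateGaussian hM]
    convert! hlim using 2 with n
    · have hm : AEMeasurable (fun ω => -T (S n ω)) P := by
        have := hS n
        fun_prop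
      rw [charFun_apply, charFun_apply, integral_map hm (by fun_prop),
        integral_map (hS n) (by fun_prop)]
      simp only [hsymm]
    · simp

end Normality

end ClusteredM

end

theorem theorem3p3 {d : ℕ}
    {Ω : Type*} [MeasurableSpace Ω] (P : Measure Ω) [IsProbabilityMeasure P]
    -- the parameter set and the parameter
    (Θ : Set (EuclideanSpace ℝ (Fin d))) (hΘconv : Convex ℝ Θ)
    (hΘbdd : Bornology.IsBounded Θ) (hΘint : (interior Θ).Nonempty)
    (θ : EuclideanSpace ℝ (Fin d)) (hθ : θ ∈ Θ)
    -- the clusters: independent, with a common marginal law and exchangeable pairs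
    (m : ℕ → ℕ) (hm : ∀ i, 1 ≤ m i)
    (μ : Measure (EuclideanSpace ℝ (Fin d))) (hμ : μ ≪ volume)
    (X : (i : ℕ) → Fin (m i) → Ω → EuclideanSpace ℝ (Fin d))
    (hXmeas : ∀ i j, Measurable (X i j))
    (hXlaw : ∀ i j, P.map (X i j) = μ)
    (hXindep : iIndepFun (fun i ω j => X i j ω) P)
    (hXpair : ∀ i (j j' k k' : Fin (m i)), j ≠ j' → k ≠ k' →
      IdentDistrib (fun ω => (X i j ω, X i j' ω)) (fun ω => (X i k ω, X i k' ω)) P P)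
    (ℓ : ℝ) (hℓ : 0 < ℓ)
    (hN : Tendsto (fun n : ℕ => (ClusteredM.totalSize m n : ℝ) / n) atTop (𝓝 ℓ))
    -- the weights
    (w : (i : ℕ) → Fin (m i) → ℝ) (hw : ∀ i j, 0 < w i j)
    -- the objective function: `θ` minimizes `a ↦ E ρ(X - a)` over `Θ`
    (ρ : EuclideanSpace ℝ (Fin d) → ℝ) (hρ : Differentiable ℝ ρ)
    (hρint : ∀ a ∈ Θ, Integrable (fun x => ρ (x - a)) μ)
    (hmin : IsMinOn (fun a => ∫ x, ρ (x - a) ∂μ) Θ θ)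
    -- `θ` is the unique zero of `a ↦ E ψ(X - a)`
    (hzero : ∀ a ∈ closure Θ, ∫ x, ClusteredM.score ρ x a ∂μ = 0 ↔ a = θ)
    -- `a ↦ ψ̇(x - a)` exists and is Hölder, uniformly in `x`
    (hψ : ∀ x, Differentiable ℝ (ClusteredM.score ρ x))
    (K lam : ℝ) (hlam0 : 0 < lam) (hlam1 : lam ≤ 1)
    (hHolder : ∀ x, ∀ a ∈ Θ, ∀ b ∈ Θ,
      ‖ClusteredM.scoreDeriv ρ x a - ClusteredM.scoreDeriv ρ x b‖ ≤ K * ‖a - b‖ ^ lam)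
    -- the entries of `ψ̇(X - θ)` are square integrable and its mean `V_θ` is invertible
    (hψsq : ∀ k l, Integrable (fun x => ClusteredM.scoreJacobian ρ x θ k l ^ 2) μ)
    (hV : IsUnit (ClusteredM.meanJacobian ρ μ θ))
    -- the weights have mean one in the limit and satisfy Kolmogorov's condition
    (hw_mean : Tendsto (fun n : ℕ => (∑ i ∈ Finset.range n, ∑ j, w i j) /
      (ClusteredM.totalSize m n : ℝ)) atTop (𝓝 1))
    (hw_kol : Summable (fun i : ℕ => ClusteredM.clusterWeight w i ^ 2 / ((i : ℝ) + 1) ^ 2))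
    -- the limits `c_w` and `C_θ^w`, and the moment condition
    (cw : ℝ)
    (hcw : Tendsto (fun n : ℕ => (∑ i ∈ Finset.range n, ∑ j, w i j ^ 2) /
      (ClusteredM.totalSize m n : ℝ)) atTop (𝓝 cw))
    (Cw : Matrix (Fin d) (Fin d) ℝ)
    (hCw : Tendsto (fun n : ℕ => (ClusteredM.totalSize m n : ℝ)⁻¹ •
      ClusteredM.crossSum P ρ θ w X n) atTop (𝓝 Cw))
    (hmoment : ∃ η : ℝ, 0 < η ∧
      (∃ L : ℝ, Tendsto (fun n : ℕ => (∑ i ∈ Finset.range n,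
        ClusteredM.clusterWeight w i ^ (2 + η)) / (ClusteredM.totalSize m n : ℝ))
        atTop (𝓝 L)) ∧
      Integrable (fun x => ‖ClusteredM.score ρ x θ‖ ^ (2 + η)) μ)
    -- the estimator: almost surely, for all large `n`, a zero in `Θ` of the estimating function
    (θhat : ℕ → Ω → EuclideanSpace ℝ (Fin d)) (hθhat_meas : ∀ n, AEMeasurable (θhat n) P)
    (hθhat : ∀ᵐ ω ∂P, ∀ᶠ n in atTop,
      θhat n ω ∈ Θ ∧ ClusteredM.weightedScore ρ w X n ω (θhat n ω) = 0) :
    (∀ᵐ ω ∂P, Tendsto (fun n => θhat n ω) atTop (𝓝 θ)) ∧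
    (ClusteredM.asymptoticCov ρ μ θ cw Cw).PosSemidef ∧
    TendstoInDistribution
      (fun (n : ℕ) ω => √(ClusteredM.totalSize m n : ℝ) • (θhat n ω - θ)) atTop id
      (fun _ => P) (multivariateGaussian 0 (ClusteredM.asymptoticCov ρ μ θ cw Cw)) := by
  have hX : ∀ i j, MeasurePreserving (X i j) P μ := fun i j => ⟨hXmeas i j, hXlaw i j⟩
  have hμp : IsProbabilityMeasure μ := hXlaw 0 ⟨0, hm 0⟩ ▸
    Measure.isProbabilityMeasure_map (hXmeas 0 ⟨0, hm 0⟩).aemeasurable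
  have hsm : Measurable fun x => ClusteredM.score ρ x θ :=
    (ClusteredM.continuous_score_left hρ hψ θ).measurable
  have hmean : ∫ x, ClusteredM.score ρ x θ ∂μ = 0 := (hzero θ (subset_closure hθ)).2 rfl
  obtain ⟨η, hη, ⟨L, hL⟩, hint⟩ := hmoment
  -- The exponent is lowered to `2 + min η 1`, since the Taylor estimate for the characteristic
  -- function requires `p ≤ 3`.
  obtain ⟨p, hp, hp3, hpη⟩ : ∃ p : ℝ, 2 < p ∧ p ≤ 3 ∧ p ≤ 2 + η :=
    ⟨2 + min η 1, by have := lt_min hη one_pos; linarith, by linarith [min_le_right η 1],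
      by linarith [min_le_left η 1]⟩
  have hintp : Integrable (fun x => ‖ClusteredM.score ρ x θ‖ ^ p) μ := by
    refine ((integrable_const (1 : ℝ)).add hint).mono'
      (hsm.norm.pow_const p).aestronglyMeasurable (ae_of_all _ fun x => ?_)
    rw [Real.norm_of_nonneg (by positivity)]
    exact ClusteredM.rpow_le_one_add_rpow (norm_nonneg _) (by linarith) hpη
  have hsc : MemLp (fun x => ClusteredM.score ρ x θ) 2 μ := by
    have h := ClusteredM.memLp_two_of_integrable_abs_rpow (P := μ) hsm.norm.aemeasurable hp.le
      (by simpa only [abs_norm] using hintp)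
    exact (memLp_norm_iff hsm.aestronglyMeasurable).1 h
  -- Lowering the exponent costs a `1` per cluster, and `n ≤ N_n` absorbs these because no cluster
  -- is empty.
  have hB : ∀ᶠ n in atTop, ∑ i ∈ Finset.range n, ClusteredM.clusterWeight w i ^ p ≤
      (1 + (L + 1)) * (ClusteredM.totalSize m n : ℝ) := by
    filter_upwards [hL.eventually_le_const (lt_add_one L), eventually_gt_atTop 0] with n hn hn0
    have hle := ClusteredM.le_totalSize hm n
    have hN0 : (0 : ℝ) < ClusteredM.totalSize m n := by exact_mod_cast hn0.trans_le hle
    rw [div_le_iff₀ hN0] at hn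
    calc ∑ i ∈ Finset.range n, ClusteredM.clusterWeight w i ^ p
        ≤ ∑ i ∈ Finset.range n, (1 + ClusteredM.clusterWeight w i ^ (2 + η)) :=
          Finset.sum_le_sum fun i _ => ClusteredM.rpow_le_one_add_rpow
            (ClusteredM.clusterWeight_pos hm hw i).le (by linarith) hpη
      _ = n + ∑ i ∈ Finset.range n, ClusteredM.clusterWeight w i ^ (2 + η) := by
          rw [Finset.sum_add_distrib]; simp
      _ ≤ ClusteredM.totalSize m n + (L + 1) * (ClusteredM.totalSize m n : ℝ) := by
          have : (n : ℝ) ≤ ClusteredM.totalSize m n := by exact_mod_cast hle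
          linarith
      _ = _ := by ring
  have hcons := ClusteredM.ae_tendsto_estimator hΘconv hΘbdd hθ hm hw hX hXindep hℓ hN hw_mean
    hw_kol hρ hψ hzero hlam0 hHolder hψsq hsc hθhat
  have hpsd := ClusteredM.posSemidef_asymptoticCov hρ hψ
    (ClusteredM.posSemidef_limit hX hsm hsc hcw hCw)
  refine ⟨hcons, hpsd, ?_⟩
  have hSm : ∀ n, Measurable fun ω =>
      (√(ClusteredM.totalSize m n : ℝ))⁻¹ • ClusteredM.weightedScore ρ w X n ω θ := fun n =>
    (Finset.measurable_fun_sum (Finset.range n) fun i _ => Finset.measurable_fun_sum Finset.univ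
      fun j _ => (hsm.comp (hXmeas i j)).const_smul (w i j)).const_smul
        (√(ClusteredM.totalSize m n : ℝ))⁻¹
  have hVinv : ((ClusteredM.meanJacobian ρ μ θ)⁻¹).transpose =
      (ClusteredM.meanJacobian ρ μ θ)⁻¹ := by
    rw [Matrix.transpose_nonsing_inv, ClusteredM.meanJacobian_transpose hρ hψ]
  refine ClusteredM.tendstoInDistribution_of_ae_isLittleO
    (fun n => ((hθhat_meas n).sub_const θ).const_smul (√(ClusteredM.totalSize m n : ℝ))) ?_
    (ClusteredM.tendstoInDistribution_linear hVinv hpsd (fun n => (hSm n).aemeasurable)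
      (ClusteredM.tendsto_charFun_weightedScore hm hw hX hXindep hsm hsc hmean hcw hCw hp hp3
        hintp hB))
  filter_upwards [hcons, hθhat, ClusteredM.ae_tendsto_scoreDeriv_average hm hw hX hXindep hℓ hN
    hw_mean hw_kol hρ hψ hψsq] with ω h1 h2 h3
  have hlin := ClusteredM.isLittleO_linearization hw hΘconv hθ hw_mean hψ hlam0 hHolder h3 h1 h2
  -- Applying `V⁻¹` and multiplying by `√N` preserves the little-o relation and puts it in the form
  -- `U - W = o(U)`.
  have hsqrt := (Asymptotics.isBigO_refl (fun n => √(ClusteredM.totalSize m n : ℝ))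
    atTop).smul_isLittleO ((ContinuousLinearMap.isBigO_comp (Matrix.toEuclideanCLM (𝕜 := ℝ)
      (ClusteredM.meanJacobian ρ μ θ)⁻¹) _ _).trans_isLittleO hlin)
  refine hsqrt.congr (fun n => ?_) fun n => rfl
  have hinv : Matrix.toEuclideanCLM (𝕜 := ℝ) (ClusteredM.meanJacobian ρ μ θ)⁻¹
      (Matrix.toEuclideanCLM (𝕜 := ℝ) (ClusteredM.meanJacobian ρ μ θ) (θhat n ω - θ)) =
      θhat n ω - θ := by
    rw [← mul_apply_eq_comp, ← map_mul,
      Matrix.nonsing_inv_mul _ ((Matrix.isUnit_iff_isUnit_det _).1 hV), map_one,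
      one_apply_eq_self]
  -- With `0⁻¹ = 0` this holds for `n = 0` too, so the identity needs no restriction on `n`.
  have hroot : √(ClusteredM.totalSize m n : ℝ) * (ClusteredM.totalSize m n : ℝ)⁻¹ =
      (√(ClusteredM.totalSize m n : ℝ))⁻¹ := by
    rw [← div_eq_mul_inv, Real.sqrt_div_self']
    exact one_div _
  rw [map_add, hinv, map_smul, map_smul, smul_add, smul_smul, hroot, sub_neg_eq_add]
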